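/- Let $a,b,c\in\mathbb{R}$ with $a\neq0$, $b\neq0$, $a+b\neq0$, and let $H^8$ be the simply connected nilpotent Lie group with a basis $e^1,\dots,e^8$ of left invariant 1-forms satisfying $$de^1=c\,(e^{24}+e^{25}-e^{34}+e^{35}),\qquad de^2=\dots=de^7=0,\qquad de^8=a\,e^{23}+b\,e^{45}-(a+b)\,e^{67};$$ explicitly, $H^8=\mathbb{R}^8$ with coordinates $(w,x_1,y_1,x_2,y_2,x_3,y_3,z)$ and $e^1=dw+\frac cb(\frac{x_1}{a}-y_1)dx_2+c(\frac{x_1}{a}+y_1)dy_2$, $e^2=\frac1a dx_1$, $e^3=dy_1$, $e^4=\frac1b dx_2$, $e^5=dy_2$, $e^6=-\frac1{a+b}dx_3$, $e^7=dy_3$, $e^8=x_1dy_1+x_2dy_2+x_3dy_3-dz$. Let $\Gamma\subset H^8$ be a lattice (a discrete cocompact subgroup) and $M^8=\Gamma\backslash H^8$, with the metric $g=\sum_i e^i\otimes e^i$, the orientation $e^{12345678}$, the dual frame $E_1,\dots,E_8$, and the $Spin(7)$-structure $$\Phi=e^{1238}-e^{1347}+e^{1458}+e^{1678}-e^{1257}-e^{1356}+e^{1246}+e^{4567}+e^{2568}+e^{2367}+e^{2345}+e^{3468}+e^{2478}-e^{3578}.$$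 Let $H=T=*d\Phi$ and $\nabla^+=\nabla^g+\frac12T$. For a connection with connection forms $\nabla E_j=\sum_i\sigma^i_j E_i$ put $\Omega^i_j=d\sigma^i_j+\sum_k\sigma^i_k\wedge\sigma^k_j$ and $p_1=\frac1{8\pi^2}\sum_{i<j}\Omega^i_j\wedge\Omega^i_j$. For $\lambda,\mu\in\mathbb{R}$ let $A_{\lambda,\mu}$ be the metric connection on $TM^8$ with $\sigma^2_3=\sigma^4_5=\lambda e^8$, $\sigma^6_7=-2\lambda e^8$, $\sigma^2_4=\sigma^2_5=\sigma^3_5=-\mu e^1$, $\sigma^3_4=\mu e^1$, $\sigma^j_i=-\sigma^i_j$, and all other $\sigma^i_j=0$; write $F$ for its curvature. **Theorem.** Suppose that $(\lambda,\mu)\neq(0,0)$, $3\lambda^2<a^2+ab+b^2$ and $3\lambda^2-2\mu^2=a^2+ab+b^2-2c^2$, and put $\alpha'=2(a^2+ab+b^2-3\lambda^2)^{-1}$. Then $\alpha'>0$ and: 1. $M^8$ is compact, $\Phi$ is balanced (its Lee form $-\frac17*(*d\Phi\wedge\Phi)$ vanishes), and $A_{\lambda,\mu}$ is a $Spin(7)$-instanton: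 it preserves $g$ and $\Phi$, and each of its curvature 2-forms satisfies $\sum_{k,l}\Omega(E_k,E_l)\Phi(E_m,E_n,E_k,E_l)=-2\,\Omega(E_m,E_n)$. 2. The anomaly cancellation condition $dT=2\pi^2\alpha'\,\big(p_1(\nabla^+)-p_1(A_{\lambda,\mu})\big)$ holds. 3. The supersymmetry equations hold with any constant dilaton $\phi$: there is a smooth nowhere vanishing real chiral spinor field $\epsilon$ on $M^8$, of unit length and corresponding to $\Phi$ (that is, with the convention $v\cdot v=-|v|^2$, $\Phi(E_i,E_j,E_k,E_l)=-\langle\epsilon,E_i\cdot E_j\cdot E_k\cdot E_l\cdot\epsilon\rangle$ for $i<j<k<l$), such that $\nabla^+\epsilon=0$, $(d\phi-\frac12H)\cdot\epsilon=0$ and $F\cdot\epsilon=0$. 4. If $a=b$ (so that the hypotheses read $\lambda^2<a^2$, $3\lambda^2-2\mu^2=3a^2-2c^2$), then the heterotic equations of motion hold with this $\alpha'$, with constant $\phi$, and with $R$ the curvature of $\nabla^+$: $$Ric^g_{ij}-\tfrac14H_{imn}H_{jmn}+2\nabla^g_i\nabla^g_j\phi-\tfrac{\alpha'}4\sum_m\sum_{r<s}\Big[F_{im\,rs}F_{jm\,rs}-R_{im\,rs}R_{jm\,rs}\Big]=0,$$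 $$\nabla^g_i(e^{-2\phi}H_{ijk})=0,\qquad \nabla^+_i(e^{-2\phi}F_{ij})=0,$$ where $\Omega_{im\,rs}=\Omega^r_s(E_i,E_m)$ for each of the two connections, and the last covariant derivative is coupled to $A_{\lambda,\mu}$ on the bundle indices of $F$. 5. In the above coordinates $$g=\Big(dw+\tfrac cb(\tfrac{x_1}a-y_1)dx_2+c(\tfrac{x_1}a+y_1)dy_2\Big)^2+\tfrac1{a^2}dx_1^2+dy_1^2+\tfrac1{b^2}dx_2^2+dy_2^2+\tfrac1{(a+b)^2}dx_3^2+dy_3^2+(x_1dy_1+x_2dy_2+x_3dy_3-dz)^2 .$$ -/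

import Mathlib

open scoped ContDiff

namespace Heterotic

/-! ### The nilpotent Lie group `H⁸`

Throughout, the paper-style indices `1, …, 8` are written `0, …, 7`; the global coordinates
`(w, x₁, y₁, x₂, y₂, x₃, y₃, z)` are the entries `0, …, 7` of `coord`. -/

/-- The underlying space `ℝ⁸` of the simply connected nilpotent Lie group `H⁸` with structure
equations `de¹ = c(e²⁴ + e²⁵ - e³⁴ + e³⁵)`, `de² = ⋯ = de⁷ = 0`,
`de⁸ = a e²³ + b e⁴⁵ - (a + b) e⁶⁷`. -/
@[ext]
structure H8 (a b c : ℝ) where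
  coord : Fin 8 → ℝ

section Group

variable {a b c : ℝ}

/-- The group law: left translation by `x` is `y ↦ x * y`. The last coordinate is that of the
generalized Heisenberg group `H(3,1)`. -/
noncomputable instance : Mul (H8 a b c) where
  mul x y := ⟨![
    x.coord 0 + y.coord 0 - c / b * (x.coord 1 / a - x.coord 2) * y.coord 3
      - c * (x.coord 1 / a + x.coord 2) * y.coord 4,
    x.coord 1 + y.coord 1, x.coord 2 + y.coord 2, x.coord 3 + y.coord 3,
    x.coord 4 + y.coord 4, x.coord 5 + y.coord 5, x.coord 6 + y.coord 6,
    x.coord 7 + y.coord 7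
      + (x.coord 1 * y.coord 2 + x.coord 3 * y.coord 4 + x.coord 5 * y.coord 6)]⟩

instance : One (H8 a b c) := ⟨⟨0⟩⟩

noncomputable instance : Inv (H8 a b c) where
  inv x := ⟨![
    -x.coord 0 - c / b * (x.coord 1 / a - x.coord 2) * x.coord 3
      - c * (x.coord 1 / a + x.coord 2) * x.coord 4,
    -x.coord 1, -x.coord 2, -x.coord 3, -x.coord 4, -x.coord 5, -x.coord 6,
    -x.coord 7 + (x.coord 1 * x.coord 2 + x.coord 3 * x.coord 4 + x.coord 5 * x.coord 6)]⟩

theorem mul_coord (x y : H8 a b c) : (x * y).coord = ![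
    x.coord 0 + y.coord 0 - c / b * (x.coord 1 / a - x.coord 2) * y.coord 3
      - c * (x.coord 1 / a + x.coord 2) * y.coord 4,
    x.coord 1 + y.coord 1, x.coord 2 + y.coord 2, x.coord 3 + y.coord 3,
    x.coord 4 + y.coord 4, x.coord 5 + y.coord 5, x.coord 6 + y.coord 6,
    x.coord 7 + y.coord 7
      + (x.coord 1 * y.coord 2 + x.coord 3 * y.coord 4 + x.coord 5 * y.coord 6)] := rfl

theorem one_coord : (1 : H8 a b c).coord = 0 := rfl

theorem inv_coord (x : H8 a b c) : (x⁻¹).coord = ![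
    -x.coord 0 - c / b * (x.coord 1 / a - x.coord 2) * x.coord 3
      - c * (x.coord 1 / a + x.coord 2) * x.coord 4,
    -x.coord 1, -x.coord 2, -x.coord 3, -x.coord 4, -x.coord 5, -x.coord 6,
    -x.coord 7 + (x.coord 1 * x.coord 2 + x.coord 3 * x.coord 4 + x.coord 5 * x.coord 6)] := rfl

noncomputable instance : Group (H8 a b c) :=
  Group.ofLeftAxioms
    (by
      intro x y z
      ext i
      fin_cases i <;> simp [mul_coord] <;> ring)
    (by
      intro x
      ext i
      fin_cases i <;> simp [mul_coord, one_coord])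
    (by
      intro x
      ext i
      fin_cases i <;> simp [mul_coord, one_coord, inv_coord] <;> ring)

instance : TopologicalSpace (H8 a b c) :=
  TopologicalSpace.induced H8.coord inferInstance

end Group

/-! ### The left invariant frame and coframe -/

/-- The coframe `e¹, …, e⁸` at the point with coordinates `x`, evaluated on a tangent vector `u`
written in the coordinate basis. -/
noncomputable def coframe (a b c : ℝ) (i : Fin 8) (x u : Fin 8 → ℝ) : ℝ :=
  ![u 0 + c / b * (x 1 / a - x 2) * u 3 + c * (x 1 / a + x 2) * u 4,
    1 / a * u 1, u 2, 1 / b * u 3, u 4, -1 / (a + b) * u 5, u 6,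
    x 1 * u 2 + x 3 * u 4 + x 5 * u 6 - u 7] i

/-- The dual frame `E₁, …, E₈` of left invariant vector fields, in the coordinate basis. -/
noncomputable def frame (a b c : ℝ) (i : Fin 8) (x : Fin 8 → ℝ) : Fin 8 → ℝ :=
  ![![1, 0, 0, 0, 0, 0, 0, 0],
    ![0, a, 0, 0, 0, 0, 0, 0],
    ![0, 0, 1, 0, 0, 0, 0, x 1],
    ![-c * (x 1 / a - x 2), 0, 0, b, 0, 0, 0, 0],
    ![-c * (x 1 / a + x 2), 0, 0, 0, 1, 0, 0, x 3],
    ![0, 0, 0, 0, 0, -(a + b), 0, 0],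
    ![0, 0, 0, 0, 0, 0, 1, x 5],
    ![0, 0, 0, 0, 0, 0, 0, -1]] i

theorem coframe_frame {a b : ℝ} (c : ℝ) (ha : a ≠ 0) (hb : b ≠ 0) (hab : a + b ≠ 0)
    (i j : Fin 8) (x : Fin 8 → ℝ) :
    coframe a b c i x (frame a b c j x) = if i = j then 1 else 0 := by
  fin_cases i <;> fin_cases j <;> simp [coframe, frame] <;> field_simp <;> ring

/-- The one-parameter subgroup `t ↦ exp (t Eᵢ)` of `H⁸`. -/
noncomputable def expFrame (a b c : ℝ) (i : Fin 8) (t : ℝ) : H8 a b c :=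
  ⟨t • frame a b c i 0⟩

theorem expFrame_add (a b c : ℝ) (i : Fin 8) (s t : ℝ) :
    expFrame a b c i (s + t) = expFrame a b c i s * expFrame a b c i t := by
  ext k
  fin_cases i <;> fin_cases k <;> simp [expFrame, frame, mul_coord] <;> ring

/-- The flow of the vector field `Eᵢ` is right translation by `exp (t Eᵢ)`; in particular `Eᵢ`
is left invariant. -/
theorem hasDerivAt_mul_expFrame {a b : ℝ} (c : ℝ) (hb : b ≠ 0) (i : Fin 8) (x : H8 a b c) :
    HasDerivAt (fun t : ℝ => (x * expFrame a b c i t).coord) (frame a b c i x.coord) 0 := by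
  have key : ∀ t : ℝ,
      (x * expFrame a b c i t).coord = x.coord + t • frame a b c i x.coord := by
    intro t
    ext k
    fin_cases i <;> fin_cases k <;> simp [expFrame, frame, mul_coord] <;> field_simp <;> ring
  simp only [key]
  simpa using ((hasDerivAt_id (0 : ℝ)).smul_const (frame a b c i x.coord)).const_add x.coord

/-- The coefficients of the Lie bracket: `[Eᵢ, Eⱼ] = ∑ₖ bracketCoeff k i j • Eₖ`. They are
constant since the frame is left invariant, so they are read off at the neutral element. -/
noncomputable def bracketCoeff (a b c : ℝ) (k i j : Fin 8) : ℝ :=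
  coframe a b c k 0 (VectorField.lieBracket ℝ (frame a b c i) (frame a b c j) 0)

/-- The left invariant Riemannian metric `g = ∑ᵢ eⁱ ⊗ eⁱ` on `H⁸`, in the global coordinates. -/
noncomputable def metric (a b c : ℝ) (x u v : Fin 8 → ℝ) : ℝ :=
  ∑ i, coframe a b c i x u * coframe a b c i x v

/-! ### The compact nilmanifold `M⁸ = Γ \ H⁸`

Since the frame is left invariant it descends to a global frame of `Γ \ H⁸`, so a tensor field on
`Γ \ H⁸` is the same as the function which sends a point to the components of the tensor with
respect to `E₁, …, E₈`. -/

/-- The quotient `Γ \ H⁸` by left translations. -/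
abbrev Nilmanifold {a b c : ℝ} (Γ : Subgroup (H8 a b c)) : Type :=
  Quotient (QuotientGroup.rightRel Γ)

/-- `Γ` is a lattice of maximal rank: a discrete cocompact subgroup of `H⁸`. -/
def IsLattice {a b c : ℝ} (Γ : Subgroup (H8 a b c)) : Prop :=
  DiscreteTopology Γ ∧ CompactSpace (Nilmanifold Γ)

section Nilmanifold

variable {a b c : ℝ} {Γ : Subgroup (H8 a b c)}

/-- Right translation by `h` on `Γ \ H⁸`. -/
noncomputable def rightTranslate (h : H8 a b c) : Nilmanifold Γ → Nilmanifold Γ :=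
  Quotient.map (fun x => x * h) (by
    intro x y hxy
    rw [← Quotient.eq_iff_equiv, Quotient.eq, QuotientGroup.rightRel_apply] at hxy ⊢
    simpa [mul_assoc] using hxy)

/-- A function on `Γ \ H⁸` is smooth if its lift to `H⁸` is a smooth function of the global
coordinates. -/
def IsSmooth {V : Type} [NormedAddCommGroup V] [NormedSpace ℝ V] (f : Nilmanifold Γ → V) : Prop :=
  ContDiff ℝ ∞ fun x : Fin 8 → ℝ => f (Quotient.mk _ (⟨x⟩ : H8 a b c))

/-- The derivative `Eᵢ f` of a function on `Γ \ H⁸` along the vector field `Eᵢ`, whose flow is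
`p ↦ p · exp (t Eᵢ)`. -/
noncomputable def frameDeriv {V : Type} [NormedAddCommGroup V] [NormedSpace ℝ V] (i : Fin 8)
    (f : Nilmanifold Γ → V) (p : Nilmanifold Γ) : V :=
  deriv (fun t : ℝ => f (rightTranslate (expFrame a b c i t) p)) 0

end Nilmanifold

/-! ### Exterior algebra in the frame -/

/-- The exterior algebra of an 8-dimensional cotangent space with basis `e¹, …, e⁸`: a form is
stored by its coefficients with respect to `e^S = e^{s₁} ∧ ⋯ ∧ e^{sₖ}` where
`S = {s₁ < ⋯ < sₖ}`. -/
abbrev Form : Type := Finset (Fin 8) → ℝ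

/-- The sign for which `e^A ∧ e^B = sign • e^{A ∪ B}`, for disjoint `A` and `B`. -/
def shuffleSign (A B : Finset (Fin 8)) : ℤ :=
  (-1) ^ ((A ×ˢ B).filter fun p => p.2 < p.1).card

/-- The wedge product. -/
def wedge (α β : Form) : Form := fun S =>
  ∑ A ∈ S.powerset, (shuffleSign A (S \ A) : ℝ) * α A * β (S \ A)

/-- The Hodge star for the metric `∑ eⁱ ⊗ eⁱ` and the orientation `e¹ ∧ ⋯ ∧ e⁸`; on basis
elements `* e^A = ± e^{Aᶜ}` with `e^A ∧ * e^A = e¹ ∧ ⋯ ∧ e⁸`. -/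
def hodge (α : Form) : Form := fun S => (shuffleSign Sᶜ S : ℝ) * α Sᶜ

/-- The 1-form `eⁱ`. -/
def covec (i : Fin 8) : Form := fun S => if S = {i} then 1 else 0

/-- The form `e^{i₁} ∧ ⋯ ∧ e^{iₖ}`. -/
def mono : List (Fin 8) → Form
  | [] => fun S => if S = ∅ then 1 else 0
  | i :: l => wedge (covec i) (mono l)

/-- The value `α (E_{i₁}, …, E_{iₖ})` of the degree `k` part of `α`. -/
noncomputable def eval (α : Form) (l : List (Fin 8)) : ℝ := ∑ S, α S * mono l S

/-- The contraction `Eₖ ⌟ α`. -/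
def contract (k : Fin 8) (α : Form) : Form := fun S =>
  if k ∈ S then 0 else (shuffleSign {k} S : ℝ) * α (insert k S)

/-- The 2-form `deᵏ`, given by `deᵏ (Eᵢ, Eⱼ) = - eᵏ ([Eᵢ, Eⱼ])`. -/
noncomputable def dCoframe (a b c : ℝ) (k : Fin 8) : Form :=
  -∑ i, ∑ j, if i < j then bracketCoeff a b c k i j • mono [i, j] else 0

/-- The exterior derivative on `Γ \ H⁸`; for `η = ∑_S η_S e^S` this is
`∑_S (dη_S ∧ e^S + η_S de^S)`, where `de^S = ∑ₖ deᵏ ∧ (Eₖ ⌟ e^S)` by the Leibniz rule. -/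
noncomputable def extD {a b c : ℝ} {Γ : Subgroup (H8 a b c)} (η : Nilmanifold Γ → Form) :
    Nilmanifold Γ → Form := fun p =>
  ∑ m, wedge (covec m) (frameDeriv m η p) + ∑ k, wedge (dCoframe a b c k) (contract k (η p))

/-! ### The `Spin(7)`-structure -/

/-- The fundamental form `Φ` of the `Spin(7)`-structure. -/
def Phi : Form :=
  mono [0, 1, 2, 7] - mono [0, 2, 3, 6] + mono [0, 3, 4, 7] + mono [0, 5, 6, 7]
    - mono [0, 1, 4, 6] - mono [0, 2, 4, 5] + mono [0, 1, 3, 5] + mono [3, 4, 5, 6]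
    + mono [1, 4, 5, 7] + mono [1, 2, 5, 6] + mono [1, 2, 3, 4] + mono [2, 3, 5, 7]
    + mono [1, 3, 6, 7] - mono [2, 4, 6, 7]

/-- `Φ` as a 4-form on `Γ \ H⁸`: its components in the frame are constant. -/
def PhiField {a b c : ℝ} (Γ : Subgroup (H8 a b c)) : Nilmanifold Γ → Form := fun _ => Phi

section Geometry

variable {a b c : ℝ} {Γ : Subgroup (H8 a b c)}

/-- The Lee form `- (1/7) * (* dΦ ∧ Φ)` of a `Spin(7)`-structure on `Γ \ H⁸`. -/
noncomputable def leeForm (Φ : Nilmanifold Γ → Form) : Nilmanifold Γ → Form := fun p =>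
  (-(1 / 7) : ℝ) • hodge (wedge (hodge (extD Φ p)) (Φ p))

/-- A `Spin(7)`-structure is balanced if its Lee form vanishes. -/
def IsBalanced (Φ : Nilmanifold Γ → Form) : Prop := ∀ p, leeForm Φ p = 0

/-- The flux `H = T = * dΦ` of a balanced `Spin(7)`-structure. -/
noncomputable def torsion (Φ : Nilmanifold Γ → Form) : Nilmanifold Γ → Form := fun p =>
  hodge (extD Φ p)

/-! ### Connections on the tangent bundle -/

/-- A linear connection on the tangent bundle, given by its connection 1-forms
`σ i j = σⁱⱼ`, so that `∇_X Eⱼ = ∑ᵢ σⁱⱼ(X) Eᵢ`. -/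
abbrev Connection {a b c : ℝ} (Γ : Subgroup (H8 a b c)) : Type :=
  Fin 8 → Fin 8 → Nilmanifold Γ → Form

/-- The connection preserves the metric. -/
def IsMetric (σ : Connection Γ) : Prop := ∀ i j p, σ i j p = -σ j i p

/-- The structure constants `aⁱⱼₖ`, where `deⁱ = ∑_{j<k} aⁱⱼₖ eʲ ∧ eᵏ`. -/
noncomputable def structConst (a b c : ℝ) (i j k : Fin 8) : ℝ := eval (dCoframe a b c i) [j, k]

/-- The Levi-Civita connection, by the Koszul formula
`σⁱⱼ(Eₖ) = (aⁱⱼₖ - aᵏᵢⱼ + aʲₖᵢ) / 2`. -/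
noncomputable def leviCivita {a b c : ℝ} (Γ : Subgroup (H8 a b c)) : Connection Γ := fun i j _ =>
  ∑ k, (1 / 2 * (structConst a b c i j k - structConst a b c k i j + structConst a b c j k i))
    • covec k

/-- The connection `∇⁺ = ∇ᵍ + T/2` for a 3-form `T`:
`(σ⁺)ⁱⱼ(Eₖ) = (σᵍ)ⁱⱼ(Eₖ) - T(Eᵢ, Eⱼ, Eₖ)/2`. -/
noncomputable def plusConnection (T : Nilmanifold Γ → Form) : Connection Γ := fun i j p =>
  leviCivita Γ i j p - ∑ k, (1 / 2 * eval (T p) [i, j, k]) • covec k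

/-- The connection `A_{l,m}` with `σ²₃ = σ⁴₅ = l e⁸`, `σ⁶₇ = -2 l e⁸`,
`σ²₄ = σ²₅ = σ³₅ = -m e¹`, `σ³₄ = m e¹`, extended skew-symmetrically. -/
noncomputable def instantonA {a b c : ℝ} (Γ : Subgroup (H8 a b c)) (l m : ℝ) : Connection Γ :=
  fun i j _ =>
    (!![0, 0, 0, 0, 0, 0, 0, 0;
        0, 0, l, 0, 0, 0, 0, 0;
        0, -l, 0, 0, 0, 0, 0, 0;
        0, 0, 0, 0, l, 0, 0, 0;
        0, 0, 0, -l, 0, 0, 0, 0;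
        0, 0, 0, 0, 0, 0, -2 * l, 0;
        0, 0, 0, 0, 0, 2 * l, 0, 0;
        0, 0, 0, 0, 0, 0, 0, 0] i j) • covec 7
    + (!![0, 0, 0, 0, 0, 0, 0, 0;
        0, 0, 0, -m, -m, 0, 0, 0;
        0, 0, 0, m, -m, 0, 0, 0;
        0, m, -m, 0, 0, 0, 0, 0;
        0, m, m, 0, 0, 0, 0, 0;
        0, 0, 0, 0, 0, 0, 0, 0;
        0, 0, 0, 0, 0, 0, 0, 0;
        0, 0, 0, 0, 0, 0, 0, 0] i j) • covec 0

/-- The curvature 2-forms `Ωⁱⱼ = dσⁱⱼ + ∑ₖ σⁱₖ ∧ σᵏⱼ`. -/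
noncomputable def curvature (σ : Connection Γ) : Connection Γ := fun i j p =>
  extD (σ i j) p + ∑ k, wedge (σ i k p) (σ k j p)

/-- The first Pontrjagin form `(1 / 8π²) ∑_{i<j} Ωⁱⱼ ∧ Ωⁱⱼ`. -/
noncomputable def pontrjagin (σ : Connection Γ) : Nilmanifold Γ → Form := fun p =>
  (1 / (8 * Real.pi ^ 2)) •
    ∑ i, ∑ j, if i < j then wedge (curvature σ i j p) (curvature σ i j p) else 0

/-- The covariant derivative `∇_{E_m} η` of a differential form, from
`∇_{E_m} eⁱ = - ∑ⱼ σⁱⱼ(E_m) eʲ` and the Leibniz rule. -/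
noncomputable def covDeriv (σ : Connection Γ) (m : Fin 8) (η : Nilmanifold Γ → Form) :
    Nilmanifold Γ → Form := fun p =>
  frameDeriv m η p - ∑ i, ∑ j, eval (σ i j p) [m] • wedge (covec j) (contract i (η p))

/-- A `Spin(7)`-instanton: a metric connection preserving `Φ` whose curvature 2-forms satisfy
`∑_{k,l} Ω(Eₖ, Eₗ) Φ(E_m, Eₙ, Eₖ, Eₗ) = - 2 Ω(E_m, Eₙ)`. -/
structure IsSpin7Instanton (Φ : Nilmanifold Γ → Form) (A : Connection Γ) : Prop where
  isMetric : IsMetric A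
  parallel : ∀ m p, covDeriv A m Φ p = 0
  curv : ∀ i j p m n, ∑ k, ∑ l, eval (curvature A i j p) [k, l] * eval (Φ p) [m, n, k, l]
    = -2 * eval (curvature A i j p) [m, n]

/-- The anomaly cancellation condition `dH = 2π²α' (p₁(∇) - p₁(A))`. -/
def AnomalyCancellation (α' : ℝ) (H : Nilmanifold Γ → Form) (σ A : Connection Γ) : Prop :=
  ∀ p, extD H p = (2 * Real.pi ^ 2 * α') • (pontrjagin σ p - pontrjagin A p)

end Geometry

/-! ### Spinors -/

/-- Real spinors in dimension 8: the irreducible 16-dimensional real module of the Clifford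
algebra with `v · v = -|v|²`. The spinor bundle of `Γ \ H⁸` is trivialized by the frame. -/
abbrev Spinor : Type := Fin 16 → ℝ

/-- Bit masks and signs of the eight generators (each is a signed permutation matrix). -/
def cliffordShift : Fin 8 → Fin 16 := ![8, 9, 10, 12, 15, 13, 14, 11]

def cliffordMask : Fin 8 → Fin 16 := ![8, 1, 3, 7, 2, 4, 5, 6]

def cliffordSign (i : Fin 8) (s : Fin 16) : ℤ :=
  (if i = 1 then -1 else 1) *
    (if (((cliffordMask i &&& s).val.testBit 0).xor ((cliffordMask i &&& s).val.testBit 1)).xor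
      (((cliffordMask i &&& s).val.testBit 2).xor ((cliffordMask i &&& s).val.testBit 3))
      then -1 else 1)

/-- Clifford multiplication by the unit vector `Eᵢ`. -/
def clifford (i : Fin 8) (ψ : Spinor) : Spinor := fun s =>
  (cliffordSign i s : ℝ) * ψ (s ^^^ cliffordShift i)

/-- The Clifford relations `Eᵢ · Eⱼ + Eⱼ · Eᵢ = -2 δᵢⱼ`. -/
theorem clifford_relation (i j : Fin 8) (ψ : Spinor) :
    clifford i (clifford j ψ) + clifford j (clifford i ψ) = if i = j then (-2 : ℝ) • ψ else 0 := by
  have h1 : ∀ i j : Fin 8, ∀ s : Fin 16,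
      s ^^^ cliffordShift j ^^^ cliffordShift i = s ^^^ cliffordShift i ^^^ cliffordShift j := by
    decide
  have h2 : ∀ i j : Fin 8, ∀ s : Fin 16, i ≠ j →
      cliffordSign i s * cliffordSign j (s ^^^ cliffordShift i)
        + cliffordSign j s * cliffordSign i (s ^^^ cliffordShift j) = 0 := by
    decide
  have h3 : ∀ i : Fin 8, ∀ s : Fin 16,
      cliffordSign i s * cliffordSign i (s ^^^ cliffordShift i) = -1
        ∧ s ^^^ cliffordShift i ^^^ cliffordShift i = s := by
    decide
  funext s
  by_cases hij : i = j
  · subst hij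
    obtain ⟨ha, hb⟩ := h3 i s
    have ha' : (cliffordSign i s : ℝ) * (cliffordSign i (s ^^^ cliffordShift i) : ℝ) = -1 := by
      exact_mod_cast ha
    simp only [clifford, Pi.add_apply, if_true, Pi.smul_apply, smul_eq_mul, hb]
    linear_combination (2 * ψ s) * ha'
  · have ha' : (cliffordSign i s : ℝ) * (cliffordSign j (s ^^^ cliffordShift i) : ℝ)
        + (cliffordSign j s : ℝ) * (cliffordSign i (s ^^^ cliffordShift j) : ℝ) = 0 := by
      exact_mod_cast h2 i j s hij
    simp only [clifford, Pi.add_apply, if_neg hij, Pi.zero_apply, h1 i j s]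
    linear_combination (ψ (s ^^^ cliffordShift i ^^^ cliffordShift j)) * ha'

/-- The Clifford action `e^S · ψ = E_{s₁} · (E_{s₂} · (⋯ ψ))`, for `S = {s₁ < ⋯ < sₖ}`. -/
def cliffordSet (S : Finset (Fin 8)) (ψ : Spinor) : Spinor :=
  ((List.finRange 8).filter (· ∈ S)).foldr clifford ψ

/-- The Clifford action of differential forms on spinors. -/
def cliffordForm (α : Form) (ψ : Spinor) : Spinor := ∑ S, α S • cliffordSet S ψ

/-- The unit spinor `ψ` corresponds to the 4-form `Φ`:
`Φ(Eᵢ, Eⱼ, Eₖ, Eₗ) = - ⟨ψ, Eᵢ · Eⱼ · Eₖ · Eₗ · ψ⟩` for `i < j < k < l`. -/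
def Corresponds (Φ : Form) (ψ : Spinor) : Prop :=
  ψ ⬝ᵥ ψ = 1 ∧ ∀ S : Finset (Fin 8), S.card = 4 → Φ S = -(ψ ⬝ᵥ cliffordSet S ψ)

section Equations

variable {a b c : ℝ} {Γ : Subgroup (H8 a b c)}

/-- The spinor covariant derivative induced by a metric connection:
`∇_{E_m} ψ = E_m ψ + (1/4) ∑_{i,j} g(∇_{E_m} Eᵢ, Eⱼ) Eᵢ · Eⱼ · ψ`. -/
noncomputable def spinDeriv (σ : Connection Γ) (m : Fin 8) (ψ : Nilmanifold Γ → Spinor) :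
    Nilmanifold Γ → Spinor := fun p =>
  frameDeriv m ψ p
    + (1 / 4 : ℝ) • ∑ i, ∑ j, eval (σ j i p) [m] • clifford i (clifford j (ψ p))

/-- The supersymmetry equations for the spinor `ψ`, the dilaton `φ`, the flux `H`, the connection
`∇⁺ = ∇ᵍ + H/2` and the gauge connection `A`: the vanishing of the gravitino, dilatino and gaugino
variations `∇⁺ψ = 0`, `(dφ - H/2) · ψ = 0`, `F^A · ψ = 0`. The spinor is required to be a smooth
section of one of the two half-spinor bundles without zeros. -/
structure IsKillingSpinor (φ : Nilmanifold Γ → ℝ) (H : Nilmanifold Γ → Form) (A : Connection Γ)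
    (ψ : Nilmanifold Γ → Spinor) : Prop where
  smooth : IsSmooth ψ
  ne_zero : ∀ p, ψ p ≠ 0
  chiral : (∀ p, cliffordSet Finset.univ (ψ p) = ψ p) ∨
    (∀ p, cliffordSet Finset.univ (ψ p) = -ψ p)
  gravitino : ∀ m p, spinDeriv (plusConnection H) m ψ p = 0
  dilatino : ∀ p, ∑ m, frameDeriv m φ p • clifford m (ψ p)
    - (1 / 2 : ℝ) • cliffordForm (H p) (ψ p) = 0
  gaugino : ∀ i j p, cliffordForm (curvature A i j p) (ψ p) = 0

/-- The Ricci tensor `Ric(Eⱼ, Eₖ) = ∑ᵢ Ωⁱₖ(Eᵢ, Eⱼ)` of the Levi-Civita connection. -/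
noncomputable def ricci (p : Nilmanifold Γ) (j k : Fin 8) : ℝ :=
  ∑ i, eval (curvature (leviCivita Γ) i k p) [i, j]

/-- The Hessian `∇ᵍᵢ∇ᵍⱼ φ`. -/
noncomputable def hessian (φ : Nilmanifold Γ → ℝ) (p : Nilmanifold Γ) (i j : Fin 8) : ℝ :=
  frameDeriv i (frameDeriv j φ) p - ∑ k, eval (leviCivita Γ k j p) [i] * frameDeriv k φ p

/-- The quadratic curvature term `∑_m ∑_{r<s} Ω_{rs}(Eᵢ, E_m) Ω_{rs}(Eⱼ, E_m)`; the trace over the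
bundle indices is normalized as in the first Pontrjagin form. -/
noncomputable def curvSq (σ : Connection Γ) (p : Nilmanifold Γ) (i j : Fin 8) : ℝ :=
  ∑ m, ∑ r, ∑ s, if r < s then
    eval (curvature σ r s p) [i, m] * eval (curvature σ r s p) [j, m] else 0

/-- The heterotic equations of motion for the dilaton `φ`, the flux `H`, the connection `∇ = σ`
with curvature `R` and the gauge connection `A` with curvature `F`:
`Ricᵢⱼ - ¼ Hᵢₘₙ Hⱼₘₙ + 2 ∇ᵢ∇ⱼφ - (α'/4) (tr F² - tr R²)ᵢⱼ = 0`,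
`∇ᵍᵢ (exp(-2φ) Hᵢⱼₖ) = 0`, `∇⁺ᵢ (exp(-2φ) Fᵢⱼ) = 0`, where the last covariant derivative uses
`∇⁺ = ∇ᵍ + H/2` on the form indices and `A` on the bundle indices of `F`. -/
structure EquationsOfMotion (α' : ℝ) (φ : Nilmanifold Γ → ℝ) (H : Nilmanifold Γ → Form)
    (σ A : Connection Γ) : Prop where
  einstein : ∀ p i j,
    ricci p i j - 1 / 4 * ∑ m, ∑ n, eval (H p) [i, m, n] * eval (H p) [j, m, n]
      + 2 * hessian φ p i j - α' / 4 * (curvSq A p i j - curvSq σ p i j) = 0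
  flux : ∀ p,
    ∑ i, contract i (covDeriv (leviCivita Γ) i (fun q => Real.exp (-2 * φ q) • H q) p) = 0
  yangMills : ∀ r s p,
    ∑ i, contract i
      (covDeriv (plusConnection H) i (fun q => Real.exp (-2 * φ q) • curvature A r s q) p
        + Real.exp (-2 * φ p) • ∑ t, (eval (A r t p) [i] • curvature A t s p
          - eval (A t s p) [i] • curvature A r t p)) = 0

end Equations

end Heterotic

open Heterotic

/-! Every field involved has constant components in the left invariant frame, so frame derivatives
vanish and each claim becomes polynomial algebra in the structure constants. The geometry is that of
a two-dimensional fibre, spanned by `E₁` and `E₈`, over a flat six-dimensional base. On the base let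
`ω = e²³ + e⁴⁵ + e⁶⁷` and `Ψ = (e² + ie³) ∧ (e⁴ + ie⁵) ∧ (e⁶ + ie⁷)`. Up to signs and order of
factors, `Φ` is `e¹⁸ ∧ ω + ω²/2` plus the products of `e¹` with `Re Ψ` and of `e⁸` with `Im Ψ`. Both
`de¹` and `de⁸` are primitive of type (1,1), that is, they lie in `su(3) ⊂ spin(7)`. Hence they
satisfy the instanton equation and annihilate the spinor of `Φ`, and `T = e¹ ∧ de¹ + e⁸ ∧ de⁸`.

The connections `∇⁺` and `A_{λ,μ}` belong to one family of `su(3)`-connections: a diagonal part `(p,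
q, -(p+q)) e⁸` and an off-diagonal part `s e¹`. The parameters `(p, q, s)` are `(-a, -b, c)` for
`∇⁺` and `(λ, λ, μ)` for `A_{λ,μ}`. All members preserve `Φ` and the spinor
(`covDeriv_genericM_Phi`, `spinDeriv_genericM`). If `p = q` the two parts commute and the curvature
lies in the span of `de¹` and `de⁸` (`curvature_torusM_diag`).

By `pontrjagin_genericM`, `8π² p₁ = 2(p² + pq + q²) de⁸ ∧ de⁸ + 4s² de¹ ∧ de¹`, whereas `dT = de¹ ∧
de¹ + de⁸ ∧ de⁸`. Matching the `de⁸ ∧ de⁸` coefficient fixes `α'`; matching the other one is the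
second hypothesis on `λ, μ`. For `a = b` the connection `∇⁺` also has `p = q`, and the Einstein
equation holds entry by entry.

The identities are proved by reflection. Forms are lists of integer coefficients, monomials and bit
masks; each operation has a list version proved correct for all values of the variables; equality of
lists is then decided by the kernel. -/

namespace Heterotic

/-! ### Integer combinations of keys -/

/-- The value of a formal integer combination of keys. -/
def lin {κ V : Type*} [AddCommGroup V] (v : κ → V) (s : List (ℤ × κ)) : V :=
  (s.map fun t => t.1 • v t.2).sum

section Lin

variable {κ κ' κ'' V W U : Type*} [AddCommGroup V] [AddCommGroup W] [AddCommGroup U]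

@[simp] theorem lin_nil (v : κ → V) : lin v [] = 0 := rfl

@[simp] theorem lin_cons (v : κ → V) (t : ℤ × κ) (s : List (ℤ × κ)) :
    lin v (t :: s) = t.1 • v t.2 + lin v s := rfl

@[simp] theorem lin_append (v : κ → V) (s t : List (ℤ × κ)) :
    lin v (s ++ t) = lin v s + lin v t := by
  simp [lin]

/-- Scaling a combination by an integer. -/
def scaleM (n : ℤ) (s : List (ℤ × κ)) : List (ℤ × κ) := s.map fun t => (n * t.1, t.2)

theorem lin_scaleM (v : κ → V) (n : ℤ) (s : List (ℤ × κ)) :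
    lin v (scaleM n s) = n • lin v s := by
  induction s with
  | nil => simp [scaleM]
  | cons t s ih =>
    have : scaleM n (t :: s) = (n * t.1, t.2) :: scaleM n s := rfl
    rw [this, lin_cons, lin_cons, ih, smul_add, mul_smul]

theorem lin_neg (v : κ → V) (s : List (ℤ × κ)) : lin v (scaleM (-1) s) = -lin v s := by
  rw [lin_scaleM, neg_one_smul]

/-- Adding a term to a combination, merging equal keys. -/
def insertTerm [DecidableEq κ] (t : ℤ × κ) : List (ℤ × κ) → List (ℤ × κ)
  | [] => [t]
  | u :: s => if t.2 = u.2 then (t.1 + u.1, u.2) :: s else u :: insertTerm t s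

theorem lin_insertTerm [DecidableEq κ] (v : κ → V) (t : ℤ × κ) (s : List (ℤ × κ)) :
    lin v (insertTerm t s) = t.1 • v t.2 + lin v s := by
  induction s with
  | nil => simp [insertTerm]
  | cons u s ih =>
    by_cases h : t.2 = u.2
    · simp [insertTerm, h, add_smul, add_assoc]
    · simp only [insertTerm, h, if_false, lin_cons, ih]
      abel

/-- Collecting the terms of a combination with equal keys. -/
def collect [DecidableEq κ] (s : List (ℤ × κ)) : List (ℤ × κ) :=
  (s.foldr insertTerm []).filter fun t => t.1 ≠ 0

theorem lin_collect [DecidableEq κ] (v : κ → V) (s : List (ℤ × κ)) :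
    lin v (collect s) = lin v s := by
  have h1 : ∀ s : List (ℤ × κ), lin v (s.filter fun t => t.1 ≠ 0) = lin v s := by
    intro s
    induction s with
    | nil => rfl
    | cons u s ih =>
      by_cases h : u.1 = 0
      · rw [List.filter_cons_of_neg (by simpa using h), ih, lin_cons, h, zero_smul, zero_add]
      · rw [List.filter_cons_of_pos (by simpa using h), lin_cons, lin_cons, ih]
  rw [collect, h1]
  induction s with
  | nil => rfl
  | cons u s ih => rw [List.foldr_cons, lin_insertTerm, ih, lin_cons]

/-- A decidable criterion for two combinations to be equal. -/
def sameM [DecidableEq κ] (s t : List (ℤ × κ)) : Bool := (collect (s ++ scaleM (-1) t)).isEmpty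

/-- Soundness of the reflection: the collected difference is empty, so the values agree for every
`v`. No independence of the values of the keys is required. -/
theorem lin_eq_of_sameM [DecidableEq κ] {s t : List (ℤ × κ)} (h : sameM s t = true)
    (v : κ → V) : lin v s = lin v t := by
  have h2 : lin v (s ++ scaleM (-1) t) = 0 := by
    rw [← lin_collect, List.isEmpty_iff.1 h, lin_nil]
  rw [lin_append, lin_neg] at h2
  exact add_neg_eq_zero.1 h2

/-- The combination obtained by applying a map, given on keys, to a combination. -/
def bindM (f : κ → List (ℤ × κ')) (s : List (ℤ × κ)) : List (ℤ × κ') :=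
  s.flatMap fun t => scaleM t.1 (f t.2)

/-- Both sides are additive in `s`, so a symbolic operation is correct as soon as it is correct on
single keys. All later correctness proofs for linear and bilinear operations rest on this. -/
theorem lin_bindM (v : κ → V) (w : κ' → W) (L : V →+ W) (f : κ → List (ℤ × κ'))
    (h : ∀ k, lin w (f k) = L (v k)) (s : List (ℤ × κ)) :
    lin w (bindM f s) = L (lin v s) := by
  induction s with
  | nil => simp [bindM]
  | cons t s ih =>
    have : bindM f (t :: s) = scaleM t.1 (f t.2) ++ bindM f s := rfl
    rw [this, lin_append, lin_scaleM, ih, h, lin_cons, map_add, map_zsmul]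

/-- The combination obtained by applying a bilinear map, given on keys, to two combinations. -/
def bindM₂ (f : κ → κ' → List (ℤ × κ'')) (s : List (ℤ × κ)) (t : List (ℤ × κ')) :
    List (ℤ × κ'') :=
  bindM (fun k => bindM (f k) t) s

theorem lin_bindM₂ (v : κ → V) (w : κ' → W) (u : κ'' → U) (B : V →+ W →+ U)
    (f : κ → κ' → List (ℤ × κ'')) (h : ∀ k k', lin u (f k k') = B (v k) (w k'))
    (s : List (ℤ × κ)) (t : List (ℤ × κ')) :
    lin u (bindM₂ f s t) = B (lin v s) (lin w t) :=
  lin_bindM v u (B.flip (lin w t)) _ (fun k => lin_bindM w u (B (v k)) (f k) (h k) t) s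

/-- The sum of a family of combinations. -/
def sumM {n : ℕ} (f : Fin n → List (ℤ × κ)) : List (ℤ × κ) := (List.finRange n).flatMap f

theorem lin_sumM {n : ℕ} (v : κ → V) (f : Fin n → List (ℤ × κ)) :
    lin v (sumM f) = ∑ i, lin v (f i) := by
  have : ∀ l : List (Fin n), lin v (l.flatMap f) = (l.map fun i => lin v (f i)).sum := by
    intro l
    induction l with
    | nil => rfl
    | cons i l ih => rw [List.flatMap_cons, lin_append, ih, List.map_cons, List.sum_cons]
  rw [sumM, this, ← List.ofFn_eq_map, List.sum_ofFn]

theorem lin_ite (v : κ → V) (P : Prop) [Decidable P] (s : List (ℤ × κ)) :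
    lin v (if P then s else []) = if P then lin v s else 0 := by
  split_ifs <;> rfl

end Lin

/-! ### Polynomials in six real variables -/

/-- An integer polynomial in six variables; a monomial is a sorted list of variables. -/
abbrev Poly : Type := List (ℤ × List (Fin 6))

/-- The value of a monomial. -/
def wordVal (ρ : Fin 6 → ℝ) (w : List (Fin 6)) : ℝ := (w.map ρ).prod

/-- The value of a polynomial. -/
def polyVal (ρ : Fin 6 → ℝ) (P : Poly) : ℝ := lin (wordVal ρ) P

/-- The product of two monomials. -/
def mulWord (w w' : List (Fin 6)) : List (Fin 6) := w.foldr (List.orderedInsert (· ≤ ·)) w'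

/-- Ordered insertion merely permutes factors. Sorting serves only to make equal monomials equal as
keys, so that they cancel in `collect`. -/
theorem wordVal_mulWord (ρ : Fin 6 → ℝ) (w w' : List (Fin 6)) :
    wordVal ρ (mulWord w w') = wordVal ρ w * wordVal ρ w' := by
  induction w with
  | nil => simp [mulWord, wordVal]
  | cons i w ih =>
    have h : wordVal ρ (mulWord (i :: w) w') = ρ i * wordVal ρ (mulWord w w') := by
      have := ((List.perm_orderedInsert (· ≤ ·) i (mulWord w w')).map ρ).prod_eq
      simpa [wordVal, mulWord] using this
    rw [h, ih]
    simp [wordVal, mul_assoc]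

/-- The product of two polynomials. -/
def mulM : Poly → Poly → Poly := bindM₂ fun w w' => [(1, mulWord w w')]

theorem polyVal_mulM (ρ : Fin 6 → ℝ) (P Q : Poly) :
    polyVal ρ (mulM P Q) = polyVal ρ P * polyVal ρ Q :=
  lin_bindM₂ (wordVal ρ) (wordVal ρ) (wordVal ρ) (smulAddHom ℝ ℝ) _
    (fun w w' => by simp [wordVal_mulWord]) P Q

/-- A combination of `V`-valued keys with polynomial coefficients. -/
def polyLin {κ V : Type*} [AddCommGroup V] [Module ℝ V] (ρ : Fin 6 → ℝ) (v : κ → V) :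
    List (ℤ × List (Fin 6) × κ) → V :=
  lin fun k => wordVal ρ k.1 • v k.2

section PolyLin

variable {κ κ' κ'' V W U : Type*} [AddCommGroup V] [AddCommGroup W] [AddCommGroup U]
  [Module ℝ V] [Module ℝ W] [Module ℝ U]

/-- Multiplication of a combination by a polynomial. -/
def smulM : Poly → List (ℤ × List (Fin 6) × κ) → List (ℤ × List (Fin 6) × κ) :=
  bindM₂ fun w k => [(1, mulWord w k.1, k.2)]

theorem polyLin_smulM (ρ : Fin 6 → ℝ) (v : κ → V) (P : Poly)
    (s : List (ℤ × List (Fin 6) × κ)) :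
    polyLin ρ v (smulM P s) = polyVal ρ P • polyLin ρ v s :=
  lin_bindM₂ _ _ _ (smulAddHom ℝ V) _
    (fun w k => by simp [wordVal_mulWord, mul_smul]) P s

/-- Extension of a map on keys to a linear map of combinations with polynomial coefficients. -/
def mapM (f : κ → List (ℤ × κ')) :
    List (ℤ × List (Fin 6) × κ) → List (ℤ × List (Fin 6) × κ') :=
  bindM fun k => (f k.2).map fun t => (t.1, k.1, t.2)

theorem polyLin_map_key (ρ : Fin 6 → ℝ) (v : κ → V) (w : List (Fin 6)) (s : List (ℤ × κ)) :
    polyLin ρ v (s.map fun t => (t.1, w, t.2)) = wordVal ρ w • lin v s := by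
  induction s with
  | nil => simp [polyLin]
  | cons t s ih =>
    rw [polyLin] at ih ⊢
    rw [List.map_cons, lin_cons, ih, lin_cons, smul_add, smul_comm]

theorem polyLin_mapM (ρ : Fin 6 → ℝ) (v : κ → V) (w : κ' → W) (L : V →ₗ[ℝ] W)
    (f : κ → List (ℤ × κ')) (h : ∀ k, lin w (f k) = L (v k))
    (s : List (ℤ × List (Fin 6) × κ)) :
    polyLin ρ w (mapM f s) = L (polyLin ρ v s) :=
  lin_bindM _ _ L.toAddMonoidHom _ (fun k => by
    have := polyLin_map_key ρ w k.1 (f k.2)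
    rw [polyLin] at this
    rw [this, h]
    simp) s

/-- Extension of a map on keys to a bilinear map of combinations with polynomial coefficients. -/
def mapM₂ (f : κ → κ' → List (ℤ × κ'')) :
    List (ℤ × List (Fin 6) × κ) → List (ℤ × List (Fin 6) × κ') →
      List (ℤ × List (Fin 6) × κ'') :=
  bindM₂ fun k k' => (f k.2 k'.2).map fun t => (t.1, mulWord k.1 k'.1, t.2)

theorem polyLin_mapM₂ (ρ : Fin 6 → ℝ) (v : κ → V) (w : κ' → W) (u : κ'' → U)
    (B : V →ₗ[ℝ] W →ₗ[ℝ] U) (f : κ → κ' → List (ℤ × κ''))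
    (h : ∀ k k', lin u (f k k') = B (v k) (w k'))
    (s : List (ℤ × List (Fin 6) × κ)) (t : List (ℤ × List (Fin 6) × κ')) :
    polyLin ρ u (mapM₂ f s t) = B (polyLin ρ v s) (polyLin ρ w t) :=
  lin_bindM₂ _ _ _
    (AddMonoidHom.mk' (fun x => (B x).toAddMonoidHom) (fun x y => by ext; simp)) _
    (fun k k' => by
      have := polyLin_map_key ρ u (mulWord k.1 k'.1) (f k.2 k'.2)
      rw [polyLin] at this
      rw [this, h, wordVal_mulWord]
      simp [mul_smul, smul_comm (wordVal ρ k.1)]) s t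

end PolyLin

/-! ### Subsets of `Fin 8` as bit masks -/

/-- The set of the positions of the nonzero bits below `8`. -/
def maskSet (x : ℕ) : Finset (Fin 8) := Finset.univ.filter fun i => x.testBit i

@[simp] theorem mem_maskSet {x : ℕ} {i : Fin 8} : i ∈ maskSet x ↔ x.testBit i = true := by
  simp [maskSet]

theorem maskSet_or (x y : ℕ) : maskSet (x ||| y) = maskSet x ∪ maskSet y := by
  ext i; simp

/-- Masks are arbitrary naturals and `maskSet` ignores all bits from position 8 on; hence the
reduction modulo `2 ^ 8`. -/
theorem disjoint_maskSet (x y : ℕ) :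
    Disjoint (maskSet x) (maskSet y) ↔ (x &&& y) % 2 ^ 8 = 0 := by
  rw [Finset.disjoint_left]
  constructor
  · intro h
    refine Nat.eq_of_testBit_eq fun i => ?_
    rw [Nat.testBit_mod_two_pow, Nat.testBit_and, Nat.zero_testBit]
    by_cases hi : i < 8
    · have := @h ⟨i, hi⟩
      simp at this
      simpa using fun _ => this
    · simp [hi]
  · intro h i hx hy
    have : ((x &&& y) % 2 ^ 8).testBit i = true := by
      rw [Nat.testBit_mod_two_pow, Nat.testBit_and]
      simp_all
    rw [h] at this
    simp at this

theorem maskSet_eq_iff (x y : ℕ) : maskSet x = maskSet y ↔ x % 2 ^ 8 = y % 2 ^ 8 := by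
  constructor
  · intro h
    refine Nat.eq_of_testBit_eq fun i => ?_
    rw [Nat.testBit_mod_two_pow, Nat.testBit_mod_two_pow]
    by_cases hi : i < 8
    · have := congrArg (fun S => (⟨i, hi⟩ : Fin 8) ∈ S) h
      simp only [mem_maskSet, eq_iff_iff] at this
      rw [Bool.eq_iff_iff.2 this]
    · simp [hi]
  · intro h
    ext i
    have := congrArg (fun z => z.testBit i) h
    simp only [Nat.testBit_mod_two_pow, i.isLt, decide_true, Bool.true_and] at this
    rw [mem_maskSet, mem_maskSet, this]

theorem maskSet_compl (x : ℕ) : (maskSet x)ᶜ = maskSet (x ^^^ 255) := by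
  ext i
  have : (255 : ℕ).testBit i = true := by
    rw [show 255 = 2 ^ 8 - 1 from rfl, Nat.testBit_two_pow_sub_one]
    simp
  simp [Nat.testBit_xor, this]

theorem maskSet_two_pow (k : Fin 8) : maskSet (2 ^ (k : ℕ)) = {k} := by
  ext i
  simp [Nat.testBit_two_pow, Fin.ext_iff, eq_comm]

theorem maskSet_erase (k : Fin 8) (x : ℕ) (h : x.testBit k = true) :
    (maskSet x).erase k = maskSet (x ^^^ 2 ^ (k : ℕ)) := by
  ext i
  by_cases hi : i = k
  · subst hi; simp [Nat.testBit_xor, h]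
  · have : (k : ℕ) ≠ i := fun h => hi (Fin.ext h.symm)
    simp [Nat.testBit_xor, hi, this]

theorem exists_maskSet (S : Finset (Fin 8)) : ∃ x : Fin 256, maskSet x = S := by
  have h : Function.Bijective fun x : Fin 256 => maskSet x := by
    rw [Fintype.bijective_iff_injective_and_card]
    refine ⟨fun x y hxy => ?_, by simp⟩
    have := (maskSet_eq_iff x y).1 hxy
    ext
    omega
  exact h.2 S

/-- The number of inversions between two masks. -/
def inversions (x y : ℕ) : ℕ :=
  ((List.finRange 8).map fun i : Fin 8 => if x.testBit i then
    ((List.finRange 8).map fun j : Fin 8 => if j < i ∧ y.testBit j then 1 else 0).sum else 0).sum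

/-- Trades the cardinality of a filtered product of finsets for a sum over bits, which the kernel
can evaluate. -/
theorem shuffleSign_maskSet (x y : ℕ) :
    shuffleSign (maskSet x) (maskSet y) = (-1) ^ inversions x y := by
  have : ((maskSet x ×ˢ maskSet y).filter fun p => p.2 < p.1).card = inversions x y := by
    rw [inversions, ← List.ofFn_eq_map, List.sum_ofFn, Finset.card_filter, Finset.sum_product,
      maskSet, Finset.sum_filter]
    refine Finset.sum_congr rfl fun i _ => ?_
    split_ifs
    · rw [← List.ofFn_eq_map, List.sum_ofFn, maskSet, Finset.sum_filter]
      refine Finset.sum_congr rfl fun j _ => ?_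
      split_ifs <;> simp_all
    · rfl
  rw [shuffleSign, this]

/-! ### The operations of the exterior algebra on basis elements -/

/-- The basis element `e^A`. -/
def basisForm (A : Finset (Fin 8)) : Form := Pi.single A 1

theorem wedge_basisForm (A B : Finset (Fin 8)) :
    wedge (basisForm A) (basisForm B) =
      if Disjoint A B then shuffleSign A B • basisForm (A ∪ B) else 0 := by
  funext S
  -- In the sum over splittings of `S`, only the one with first block `A` can contribute.
  have h1 : wedge (basisForm A) (basisForm B) S =
      if A ⊆ S ∧ S \ A = B then (shuffleSign A B : ℝ) else 0 := by
    rw [wedge]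
    by_cases hA : A ⊆ S
    · rw [Finset.sum_eq_single_of_mem A (Finset.mem_powerset.2 hA)]
      · by_cases hB : S \ A = B
        · simp [basisForm, hA, hB]
        · simp [basisForm, hB]
      · intro A' _ h
        simp [basisForm, h]
    · rw [Finset.sum_eq_zero]
      · simp [hA]
      · intro A' h
        have : A' ≠ A := fun e => hA (e ▸ Finset.mem_powerset.1 h)
        simp [basisForm, this]
  rw [h1]
  by_cases hd : Disjoint A B
  · rw [if_pos hd]
    by_cases hS : S = A ∪ B
    · subst hS
      simp [basisForm, Finset.union_sdiff_cancel_left hd]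
    · rw [if_neg]
      · simp [basisForm, hS]
      · rintro ⟨hA, rfl⟩
        exact hS (Finset.union_sdiff_of_subset hA).symm
  · rw [if_neg hd, if_neg]
    · rfl
    · rintro ⟨_, rfl⟩
      exact hd Finset.disjoint_sdiff

theorem hodge_basisForm (A : Finset (Fin 8)) :
    hodge (basisForm A) = shuffleSign A Aᶜ • basisForm Aᶜ := by
  funext S
  by_cases h : S = Aᶜ
  · subst h; simp [hodge, basisForm]
  · have : Sᶜ ≠ A := fun e => h (by rw [← e, compl_compl])
    simp [hodge, basisForm, h, this]

theorem contract_basisForm (k : Fin 8) (A : Finset (Fin 8)) :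
    contract k (basisForm A) =
      if k ∈ A then shuffleSign {k} (A.erase k) • basisForm (A.erase k) else 0 := by
  funext S
  by_cases hk : k ∈ A
  · rw [if_pos hk]
    by_cases h : S = A.erase k
    · subst h; simp [contract, basisForm, Finset.insert_erase hk]
    · by_cases hS : k ∈ S
      · simp [contract, hS, basisForm, h]
      · have : insert k S ≠ A := fun e => h (by rw [← e, Finset.erase_insert hS])
        simp [contract, hS, basisForm, h, this]
  · have : insert k S ≠ A := fun e => hk (e ▸ Finset.mem_insert_self k S)
    simp [contract, basisForm, hk, this]

theorem covec_eq_basisForm (i : Fin 8) : covec i = basisForm {i} := by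
  funext S; simp [covec, basisForm, Pi.single_apply]

/-- The wedge product as a bilinear map. -/
def wedgeₗ : Form →ₗ[ℝ] Form →ₗ[ℝ] Form :=
  LinearMap.mk₂ ℝ wedge
    (fun x y z => by
      funext S; simp [wedge, ← Finset.sum_add_distrib, mul_add, add_mul])
    (fun r x y => by
      funext S; simp only [wedge, Pi.smul_apply, smul_eq_mul, Finset.mul_sum]
      exact Finset.sum_congr rfl fun _ _ => by ring)
    (fun x y z => by
      funext S; simp [wedge, ← Finset.sum_add_distrib, mul_add])
    (fun r x y => by
      funext S; simp only [wedge, Pi.smul_apply, smul_eq_mul, Finset.mul_sum]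
      exact Finset.sum_congr rfl fun _ _ => by ring)

/-- The Hodge star as a linear map. -/
def hodgeₗ : Form →ₗ[ℝ] Form where
  toFun := hodge
  map_add' x y := by funext S; simp [hodge, mul_add]
  map_smul' r x := by funext S; simp [hodge, mul_left_comm]

/-- The contraction as a linear map. -/
def contractₗ (k : Fin 8) : Form →ₗ[ℝ] Form where
  toFun := contract k
  map_add' x y := by funext S; by_cases h : k ∈ S <;> simp [contract, h, mul_add]
  map_smul' r x := by funext S; by_cases h : k ∈ S <;> simp [contract, h, mul_left_comm]

/-- The pairing of coefficients as a bilinear map. -/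
def pairₗ : Form →ₗ[ℝ] Form →ₗ[ℝ] ℝ :=
  LinearMap.mk₂ ℝ (fun α β => ∑ S, α S * β S)
    (fun x y z => by simp [← Finset.sum_add_distrib, add_mul])
    (fun r x y => by simp [Finset.mul_sum, mul_assoc])
    (fun x y z => by simp [← Finset.sum_add_distrib, mul_add])
    (fun r x y => by simp [Finset.mul_sum, mul_left_comm])

theorem pairₗ_basisForm (A B : Finset (Fin 8)) :
    pairₗ (basisForm A) (basisForm B) = if A = B then 1 else 0 := by
  change ∑ S, basisForm A S * basisForm B S = _
  simp [basisForm, Pi.single_apply, eq_comm]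

/-! ### Sparse forms -/

/-- A form with polynomial coefficients; basis elements are given by masks. -/
abbrev SForm : Type := List (ℤ × List (Fin 6) × ℕ)

/-- The form represented by a sparse form. -/
def den (ρ : Fin 6 → ℝ) : SForm → Form := polyLin ρ fun x => basisForm (maskSet x)

section SparseForms

variable (ρ : Fin 6 → ℝ)

theorem den_append (s t : SForm) : den ρ (s ++ t) = den ρ s + den ρ t := by
  rw [den, polyLin]; exact lin_append _ s t

theorem den_neg (s : SForm) : den ρ (scaleM (-1) s) = -den ρ s := by
  rw [den, polyLin]; exact lin_neg _ s

theorem den_scaleM (n : ℤ) (s : SForm) : den ρ (scaleM n s) = (n : ℝ) • den ρ s := by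
  rw [den, polyLin, lin_scaleM, Int.cast_smul_eq_zsmul]

theorem den_collect (s : SForm) : den ρ (collect s) = den ρ s := by
  rw [den, polyLin]; exact lin_collect _ s

theorem den_sumM {n : ℕ} (f : Fin n → SForm) : den ρ (sumM f) = ∑ i, den ρ (f i) := by
  rw [den, polyLin]; exact lin_sumM _ f

theorem den_smulM (P : Poly) (s : SForm) : den ρ (smulM P s) = polyVal ρ P • den ρ s :=
  polyLin_smulM ρ _ P s

theorem den_eq_of_sameM {s t : SForm} (h : sameM s t = true) : den ρ s = den ρ t := by
  rw [den, polyLin]; exact lin_eq_of_sameM h _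

theorem polyVal_eq_of_sameM {s t : Poly} (h : sameM s t = true) : polyVal ρ s = polyVal ρ t :=
  lin_eq_of_sameM h _

theorem polyVal_sumM {n : ℕ} (f : Fin n → Poly) :
    polyVal ρ (sumM f) = ∑ i, polyVal ρ (f i) :=
  lin_sumM _ f

theorem polyVal_append (s t : Poly) : polyVal ρ (s ++ t) = polyVal ρ s + polyVal ρ t :=
  lin_append _ s t

theorem polyVal_scaleM (n : ℤ) (s : Poly) : polyVal ρ (scaleM n s) = n * polyVal ρ s := by
  rw [polyVal, lin_scaleM, zsmul_eq_mul, polyVal]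

/-- The sparse wedge product. -/
def wedgeM : SForm → SForm → SForm :=
  mapM₂ fun x y => if (x &&& y) % 2 ^ 8 = 0 then [((-1) ^ inversions x y, x ||| y)] else []

theorem den_wedgeM (s t : SForm) : den ρ (wedgeM s t) = wedge (den ρ s) (den ρ t) :=
  polyLin_mapM₂ ρ _ _ _ wedgeₗ _ (fun x y => by
    change _ = wedge _ _
    rw [wedge_basisForm, lin_ite]
    simp only [disjoint_maskSet, lin_cons, lin_nil, add_zero, shuffleSign_maskSet, maskSet_or]) s t

/-- The sparse Hodge star. -/
def hodgeM : SForm → SForm :=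
  mapM fun x => [((-1) ^ inversions x (x ^^^ 255), x ^^^ 255)]

theorem den_hodgeM (s : SForm) : den ρ (hodgeM s) = hodge (den ρ s) :=
  polyLin_mapM ρ _ _ hodgeₗ _ (fun x => by
    change _ = hodge _
    rw [hodge_basisForm]
    simp only [maskSet_compl, shuffleSign_maskSet, lin_cons, lin_nil, add_zero]) s

/-- The sparse contraction. -/
def contractM (k : Fin 8) : SForm → SForm :=
  mapM fun x => if x.testBit k then
    [((-1) ^ inversions (2 ^ (k : ℕ)) (x ^^^ 2 ^ (k : ℕ)), x ^^^ 2 ^ (k : ℕ))] else []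

theorem den_contractM (k : Fin 8) (s : SForm) :
    den ρ (contractM k s) = contract k (den ρ s) :=
  polyLin_mapM ρ _ _ (contractₗ k) _ (fun x => by
    change _ = contract k _
    rw [contract_basisForm, lin_ite]
    by_cases h : x.testBit k = true
    · simp only [mem_maskSet, h, if_true, maskSet_erase k x h, ← maskSet_two_pow k,
        shuffleSign_maskSet, lin_cons, lin_nil, add_zero]
    · simp [h]) s

/-- The sparse pairing of coefficients. -/
def pairM (s t : SForm) : Poly :=
  (mapM₂ (fun x y => if x % 2 ^ 8 = y % 2 ^ 8 then [((1 : ℤ), ())] else []) s t).map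
    fun t => (t.1, t.2.1)

theorem polyVal_pairM (s t : SForm) : polyVal ρ (pairM s t) = pairₗ (den ρ s) (den ρ t) := by
  have h : ∀ l : List (ℤ × List (Fin 6) × Unit),
      polyVal ρ (l.map fun t => (t.1, t.2.1)) = polyLin ρ (fun _ => (1 : ℝ)) l := by
    intro l
    induction l with
    | nil => rfl
    | cons t l ih =>
      rw [polyVal] at ih
      rw [polyLin] at ih ⊢
      rw [polyVal, List.map_cons, lin_cons, ih, lin_cons]
      simp
  rw [pairM, h]
  exact polyLin_mapM₂ ρ _ _ _ pairₗ _ (fun x y => by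
    rw [pairₗ_basisForm, lin_ite]
    simp only [maskSet_eq_iff, lin_cons, lin_nil, add_zero, one_smul]) s t

/-- The sparse form `eⁱ`. -/
def covecM (i : Fin 8) : SForm := [(1, [], 2 ^ (i : ℕ))]

theorem den_covecM (i : Fin 8) : den ρ (covecM i) = covec i := by
  simp [den, polyLin, covecM, wordVal, covec_eq_basisForm, maskSet_two_pow]

/-- The sparse form `e^{i₁} ∧ ⋯ ∧ e^{iₖ}`. -/
def monoM : List (Fin 8) → SForm
  | [] => [(1, [], 0)]
  | i :: l => wedgeM (covecM i) (monoM l)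

theorem den_monoM (l : List (Fin 8)) : den ρ (monoM l) = mono l := by
  induction l with
  | nil =>
    funext S
    have : maskSet 0 = ∅ := by ext; simp
    simp [den, polyLin, monoM, wordVal, mono, this, basisForm, Pi.single_apply]
  | cons i l ih => rw [monoM, den_wedgeM, ih, den_covecM, mono]

/-- The sparse evaluation of a form on vectors of the frame. -/
def evalM (s : SForm) (l : List (Fin 8)) : Poly := pairM s (monoM l)

theorem polyVal_evalM (s : SForm) (l : List (Fin 8)) :
    polyVal ρ (evalM s l) = eval (den ρ s) l := by
  rw [evalM, polyVal_pairM, den_monoM]; rfl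

end SparseForms

/-! ### The structure equations -/

/-- The `w`-components of the brackets `[Eᵢ, Eⱼ]` at the neutral element. -/
def bracketW (c : ℝ) : Matrix (Fin 8) (Fin 8) ℝ :=
  !![0, 0, 0, 0, 0, 0, 0, 0;
     0, 0, 0, -c, -c, 0, 0, 0;
     0, 0, 0, c, -c, 0, 0, 0;
     0, c, -c, 0, 0, 0, 0, 0;
     0, c, c, 0, 0, 0, 0, 0;
     0, 0, 0, 0, 0, 0, 0, 0;
     0, 0, 0, 0, 0, 0, 0, 0;
     0, 0, 0, 0, 0, 0, 0, 0]

/-- The `z`-components of the brackets `[Eᵢ, Eⱼ]` at the neutral element. -/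
def bracketZ (a b : ℝ) : Matrix (Fin 8) (Fin 8) ℝ :=
  !![0, 0, 0, 0, 0, 0, 0, 0;
     0, 0, a, 0, 0, 0, 0, 0;
     0, -a, 0, 0, 0, 0, 0, 0;
     0, 0, 0, 0, b, 0, 0, 0;
     0, 0, 0, -b, 0, 0, 0, 0;
     0, 0, 0, 0, 0, 0, -(a + b), 0;
     0, 0, 0, 0, 0, a + b, 0, 0;
     0, 0, 0, 0, 0, 0, 0, 0]

theorem fderiv_frame (a b c : ℝ) (i : Fin 8) (u : Fin 8 → ℝ) :
    fderiv ℝ (frame a b c i) 0 u = frame a b c i u - frame a b c i 0 := by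
  -- The frame fields are affine in the coordinates, so their derivative is the linear part.
  let L : (Fin 8 → ℝ) →ₗ[ℝ] (Fin 8 → ℝ) :=
    { toFun := fun u => frame a b c i u - frame a b c i 0
      map_add' := fun u v => by fin_cases i <;> simp [frame] <;> ring
      map_smul' := fun r u => by fin_cases i <;> simp [frame] <;> ring }
  have h : frame a b c i = fun x => LinearMap.toContinuousLinearMap L x + frame a b c i 0 := by
    funext x
    simp [L]
  have h2 : HasFDerivAt (frame a b c i) (LinearMap.toContinuousLinearMap L) 0 := by
    rw [h]
    exact (LinearMap.toContinuousLinearMap L).hasFDerivAt.add_const _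
  rw [h2.fderiv]
  rfl

/-- Two-step nilpotency: all brackets fall in the span of `∂_w` and `∂_z`, the fibre directions. -/
theorem lieBracket_frame {a b : ℝ} (c : ℝ) (ha : a ≠ 0) (i j : Fin 8) :
    VectorField.lieBracket ℝ (frame a b c i) (frame a b c j) 0 =
      ![bracketW c i j, 0, 0, 0, 0, 0, 0, bracketZ a b i j] := by
  rw [VectorField.lieBracket, fderiv_frame, fderiv_frame]
  fin_cases i <;> fin_cases j <;> simp [frame, bracketW, bracketZ, ha] <;>
    (funext k; fin_cases k <;> rfl)

theorem bracketCoeff_eq {a b : ℝ} (c : ℝ) (ha : a ≠ 0) (k i j : Fin 8) :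
    bracketCoeff a b c k i j =
      ![bracketW c i j, 0, 0, 0, 0, 0, 0, -bracketZ a b i j] k := by
  rw [bracketCoeff, lieBracket_frame c ha]
  fin_cases k <;> simp [coframe]

/-- The values `(a/2, b/2, c/2, p, q, s)` of the six variables. -/
noncomputable def env (a b c p q s : ℝ) : Fin 6 → ℝ := ![a / 2, b / 2, c / 2, p, q, s]

/-- The sparse forms representing `deᵏ / 2`. -/
def halfDM (k : Fin 8) : SForm :=
  if k = 0 then [(1, [2], 10), (1, [2], 18), (-1, [2], 12), (1, [2], 20)]
  else if k = 7 then [(1, [0], 6), (1, [1], 24), (-1, [0], 96), (-1, [1], 96)]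
  else []

/-- The sparse forms representing `deᵏ`. -/
def dCoframeM (k : Fin 8) : SForm := scaleM 2 (halfDM k)

/-- This links the brackets of the group to the symbolic calculus. Later lemmas take it as the
hypothesis `hρ`; the values `p, q, s` stay free for connection parameters. -/
theorem dCoframe_eq {a b : ℝ} (c p q s : ℝ) (ha : a ≠ 0) (k : Fin 8) :
    dCoframe a b c k = den (env a b c p q s) (dCoframeM k) := by
  have hm : ∀ (i j : Fin 8) (x : ℕ), sameM (monoM [i, j]) [(1, [], x)] = true →
      mono [i, j] = basisForm (maskSet x) := fun i j x h => by
    rw [← den_monoM (env a b c p q s), den_eq_of_sameM _ h]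
    simp [den, polyLin, wordVal]
  fin_cases k
  · simp only [dCoframe, bracketCoeff_eq c ha, bracketW, Fin.sum_univ_eight]
    simp [den, polyLin, dCoframeM, halfDM, scaleM, wordVal, env,
      hm 1 3 10 (by decide), hm 1 4 18 (by decide), hm 2 3 12 (by decide), hm 2 4 20 (by decide)]
    funext S
    simp only [Pi.add_apply, Pi.neg_apply, Pi.smul_apply, Pi.mul_apply, smul_eq_mul, Pi.ofNat_apply]
    ring
  any_goals
    simp [dCoframe, bracketCoeff_eq c ha, dCoframeM, halfDM, scaleM, den, polyLin]
  simp only [bracketZ, Fin.sum_univ_eight]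
  simp [wordVal, env, hm 1 2 6 (by decide), hm 3 4 24 (by decide), hm 5 6 96 (by decide)]
  funext S
  simp only [Pi.add_apply, Pi.neg_apply, Pi.smul_apply, Pi.mul_apply, smul_eq_mul, Pi.ofNat_apply]
  ring

/-! ### Left invariant fields -/

section Invariant

variable {a b c : ℝ} {Γ : Subgroup (H8 a b c)} {ρ : Fin 6 → ℝ}

theorem frameDeriv_const {V : Type} [NormedAddCommGroup V] [NormedSpace ℝ V] (i : Fin 8) (v : V) :
    frameDeriv i (fun _ : Nilmanifold Γ => v) = fun _ => 0 := by
  funext x; simp [frameDeriv]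

/-- The sparse exterior derivative of left invariant forms. -/
def extM (s : SForm) : SForm := collect (sumM fun k => wedgeM (dCoframeM k) (contractM k s))

theorem extD_den (hρ : ∀ k, dCoframe a b c k = den ρ (dCoframeM k)) (s : SForm) :
    extD (fun _ : Nilmanifold Γ => den ρ s) = fun _ => den ρ (extM s) := by
  funext x
  have h0 : ∀ i, wedge (covec i) 0 = 0 := fun i => map_zero (wedgeₗ (covec i))
  simp only [extD, frameDeriv_const, h0, Finset.sum_const_zero, zero_add, extM, den_collect,
    den_sumM, den_wedgeM, den_contractM, hρ]

/-- The left invariant connection represented by a matrix of sparse forms. -/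
def denConn (Γ : Subgroup (H8 a b c)) (ρ : Fin 6 → ℝ) (S : Fin 8 → Fin 8 → SForm) :
    Connection Γ := fun i j _ => den ρ (S i j)

theorem denConn_congr {S S' : Fin 8 → Fin 8 → SForm}
    (h : ∀ i j, sameM (S i j) (S' i j) = true) : denConn Γ ρ S = denConn Γ ρ S' := by
  funext i j x; exact den_eq_of_sameM ρ (h i j)

/-- The sparse curvature forms. -/
def curvM (S : Fin 8 → Fin 8 → SForm) (i j : Fin 8) : SForm :=
  collect (extM (S i j) ++ sumM fun k => wedgeM (S i k) (S k j))

theorem curvature_denConn (hρ : ∀ k, dCoframe a b c k = den ρ (dCoframeM k))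
    (S : Fin 8 → Fin 8 → SForm) : curvature (denConn Γ ρ S) = denConn Γ ρ (curvM S) := by
  funext i j x
  have h : ∀ i j, denConn Γ ρ S i j = fun _ => den ρ (S i j) := fun _ _ => rfl
  simp only [curvature, h, extD_den hρ]
  simp only [denConn, curvM, den_collect, den_append, den_sumM, den_wedgeM]

/-- The sparse form `∑_{i<j} Rⁱⱼ ∧ Rⁱⱼ`. -/
def pontM (R : Fin 8 → Fin 8 → SForm) : SForm :=
  sumM fun i => sumM fun j => if i < j then wedgeM (R i j) (R i j) else []

theorem pontrjagin_of_curvature {σ : Connection Γ} {R : Fin 8 → Fin 8 → SForm}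
    (h : curvature σ = denConn Γ ρ R) (x : Nilmanifold Γ) :
    pontrjagin σ x = (1 / (8 * Real.pi ^ 2)) • den ρ (pontM R) := by
  have h0 : ∀ (P : Prop) [Decidable P] (s : SForm),
      den ρ (if P then s else []) = if P then den ρ s else 0 := fun P _ s => by
    split_ifs <;> rfl
  simp only [pontrjagin, h, denConn, pontM, den_sumM, h0, den_wedgeM]

/-- The sparse covariant derivative of left invariant forms. -/
def covM (S : Fin 8 → Fin 8 → SForm) (m : Fin 8) (s : SForm) : SForm :=
  scaleM (-1) (sumM fun i => sumM fun j =>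
    smulM (evalM (S i j) [m]) (wedgeM (covecM j) (contractM i s)))

theorem covDeriv_denConn (S : Fin 8 → Fin 8 → SForm) (m : Fin 8) (s : SForm)
    (x : Nilmanifold Γ) :
    covDeriv (denConn Γ ρ S) m (fun _ => den ρ s) x = den ρ (covM S m s) := by
  simp only [covDeriv, frameDeriv_const, zero_sub, denConn, covM, den_neg, den_sumM, den_smulM,
    polyVal_evalM, den_wedgeM, den_covecM, den_contractM]

theorem contract_smul (k : Fin 8) (r : ℝ) (α : Form) : contract k (r • α) = r • contract k α :=
  map_smul (contractₗ k) r α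

theorem covDeriv_smul_const (σ : Connection Γ) (m : Fin 8) (r : ℝ) (α : Form)
    (x : Nilmanifold Γ) :
    covDeriv σ m (fun _ => r • α) x = r • covDeriv σ m (fun _ => α) x := by
  have h : ∀ i j, wedge (covec j) (contract i (r • α)) = r • wedge (covec j) (contract i α) :=
    fun i j => by rw [contract_smul]; exact map_smul (wedgeₗ (covec j)) r _
  simp only [covDeriv, frameDeriv_const, zero_sub, h, smul_neg, Finset.smul_sum, smul_comm r]

/-! ### The Levi-Civita connection -/

/-- The skew-symmetric matrix with given entries above the diagonal. -/
def skewM (f : ℕ → ℕ → SForm) (i j : Fin 8) : SForm :=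
  if i < j then f i j else if j < i then scaleM (-1) (f j i) else []

/-- The sparse Levi-Civita connection forms above the diagonal. -/
def lcUpper : ℕ → ℕ → SForm
  | 0, 1 => [(1, [2], 8), (1, [2], 16)]
  | 0, 2 => [(-1, [2], 8), (1, [2], 16)]
  | 0, 3 => [(-1, [2], 2), (1, [2], 4)]
  | 0, 4 => [(-1, [2], 2), (-1, [2], 4)]
  | 1, 2 => [(-1, [0], 128)]
  | 1, 3 => [(-1, [2], 1)]
  | 1, 4 => [(-1, [2], 1)]
  | 1, 7 => [(-1, [0], 4)]
  | 2, 3 => [(1, [2], 1)]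
  | 2, 4 => [(-1, [2], 1)]
  | 2, 7 => [(1, [0], 2)]
  | 3, 4 => [(-1, [1], 128)]
  | 3, 7 => [(-1, [1], 16)]
  | 4, 7 => [(1, [1], 8)]
  | 5, 6 => [(1, [0], 128), (1, [1], 128)]
  | 5, 7 => [(1, [0], 64), (1, [1], 64)]
  | 6, 7 => [(-1, [0], 32), (-1, [1], 32)]
  | _, _ => []

/-- The sparse Levi-Civita connection forms. -/
def lcM : Fin 8 → Fin 8 → SForm := skewM lcUpper

/-- The factor 2 cancels the 1/2 of the Koszul formula. This is why the variables are `a/2, b/2,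
c/2`: integer coefficients then suffice. -/
theorem structConst_eq (hρ : ∀ k, dCoframe a b c k = den ρ (dCoframeM k)) (i j k : Fin 8) :
    structConst a b c i j k = 2 * polyVal ρ (evalM (halfDM i) [j, k]) := by
  have : den ρ (dCoframeM i) = (2 : ℝ) • den ρ (halfDM i) := by
    exact_mod_cast den_scaleM ρ 2 (halfDM i)
  rw [structConst, hρ, this, polyVal_evalM, eval, eval, Finset.mul_sum]
  simp [mul_assoc]

theorem leviCivita_eq (hρ : ∀ k, dCoframe a b c k = den ρ (dCoframeM k)) :
    leviCivita Γ = denConn Γ ρ lcM := by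
  have h : ∀ i j : Fin 8, sameM (lcM i j) (sumM fun k => smulM
      (evalM (halfDM i) [j, k] ++ scaleM (-1) (evalM (halfDM k) [i, j])
        ++ evalM (halfDM j) [k, i]) (covecM k)) = true := by
    decide +kernel
  rw [denConn_congr h]
  funext i j x
  simp only [leviCivita, denConn, structConst_eq hρ, den_sumM, den_smulM, den_covecM,
    polyVal_append, polyVal_scaleM]
  refine Finset.sum_congr rfl fun k _ => ?_
  congr 1
  push_cast
  ring

/-! ### The torsion -/

/-- The sparse form `Φ`. -/
def phiM : SForm :=
  [(1, [], 135), (-1, [], 77), (1, [], 153), (1, [], 225), (-1, [], 83), (-1, [], 53),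
    (1, [], 43), (1, [], 120), (1, [], 178), (1, [], 102), (1, [], 30), (1, [], 172),
    (1, [], 202), (-1, [], 212)]

theorem Phi_eq (ρ : Fin 6 → ℝ) : Phi = den ρ phiM := by
  have h : sameM phiM
      (monoM [0, 1, 2, 7] ++ scaleM (-1) (monoM [0, 2, 3, 6]) ++ monoM [0, 3, 4, 7]
        ++ monoM [0, 5, 6, 7] ++ scaleM (-1) (monoM [0, 1, 4, 6])
        ++ scaleM (-1) (monoM [0, 2, 4, 5]) ++ monoM [0, 1, 3, 5] ++ monoM [3, 4, 5, 6]
        ++ monoM [1, 4, 5, 7] ++ monoM [1, 2, 5, 6] ++ monoM [1, 2, 3, 4] ++ monoM [2, 3, 5, 7]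
        ++ monoM [1, 3, 6, 7] ++ scaleM (-1) (monoM [2, 4, 6, 7])) = true := by
    decide +kernel
  rw [den_eq_of_sameM ρ h]
  simp only [den_append, den_neg, den_monoM, Phi, sub_eq_add_neg]

/-- The sparse form `T / 2`. -/
def halfTM : SForm := wedgeM (covecM 0) (halfDM 0) ++ wedgeM (covecM 7) (halfDM 7)

/-- For `κ` primitive of type (1,1), `κ ∧ Ψ = 0` and `κ ∧ ω² = 0`, so `dΦ` comes only from `e¹⁸ ∧
ω`. The star on the base sends `κ ∧ ω` to `-κ`, which leaves `T = e¹ ∧ de¹ + e⁸ ∧ de⁸`. -/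
theorem torsion_eq (hρ : ∀ k, dCoframe a b c k = den ρ (dCoframeM k)) :
    torsion (PhiField Γ) = fun _ => den ρ (scaleM 2 halfTM) := by
  have h : sameM (hodgeM (extM phiM)) (scaleM 2 halfTM) = true := by decide +kernel
  have hP : PhiField Γ = fun _ => den ρ phiM := by funext x; exact Phi_eq ρ
  funext x
  rw [torsion, hP, extD_den hρ, ← den_hodgeM, den_eq_of_sameM ρ h]

/-- Already `T ∧ Φ = 0`, again because `κ ∧ ω²` and `κ ∧ Ψ` vanish for `κ = de¹, de⁸`. -/
theorem isBalanced (hρ : ∀ k, dCoframe a b c k = den ρ (dCoframeM k)) :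
    IsBalanced (PhiField Γ) := by
  have h : sameM (hodgeM (wedgeM (scaleM 2 halfTM) phiM)) [] = true := by decide +kernel
  intro x
  have h2 := congrFun (torsion_eq (Γ := Γ) hρ) x
  rw [torsion] at h2
  rw [leeForm, h2, PhiField, Phi_eq ρ, ← den_wedgeM, ← den_hodgeM, den_eq_of_sameM ρ h]
  exact smul_zero _

theorem extD_torsion (hρ : ∀ k, dCoframe a b c k = den ρ (dCoframeM k)) (x : Nilmanifold Γ) :
    extD (torsion (PhiField Γ)) x =
      den ρ (wedgeM (dCoframeM 0) (dCoframeM 0) ++ wedgeM (dCoframeM 7) (dCoframeM 7)) := by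
  have h : sameM (extM (scaleM 2 halfTM))
      (wedgeM (dCoframeM 0) (dCoframeM 0) ++ wedgeM (dCoframeM 7) (dCoframeM 7)) = true := by
    decide +kernel
  rw [torsion_eq hρ, extD_den hρ, den_eq_of_sameM ρ h]

/-! ### A family of invariant connections -/

/-- The forms above the diagonal of the connection with `σ²₃ = P e⁸`, `σ⁴₅ = Q e⁸`,
`σ⁶₇ = -(P + Q) e⁸`, `σ²₄ = σ²₅ = σ³₅ = -S e¹`, `σ³₄ = S e¹`. -/
def torusUpper (P Q S : Poly) : ℕ → ℕ → SForm
  | 1, 2 => smulM P (covecM 7)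
  | 3, 4 => smulM Q (covecM 7)
  | 5, 6 => smulM (scaleM (-1) (P ++ Q)) (covecM 7)
  | 1, 3 => smulM (scaleM (-1) S) (covecM 0)
  | 1, 4 => smulM (scaleM (-1) S) (covecM 0)
  | 2, 4 => smulM (scaleM (-1) S) (covecM 0)
  | 2, 3 => smulM S (covecM 0)
  | _, _ => []

/-- The connection with `σ²₃ = P e⁸`, `σ⁴₅ = Q e⁸`, `σ⁶₇ = -(P + Q) e⁸`,
`σ²₄ = σ²₅ = σ³₅ = -S e¹`, `σ³₄ = S e¹`. -/
def torusM (P Q S : Poly) : Fin 8 → Fin 8 → SForm := skewM (torusUpper P Q S)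

/-- The member of the family with generic coefficients. -/
def genericM : Fin 8 → Fin 8 → SForm := torusM [(1, [3])] [(1, [4])] [(1, [5])]

/-- The torsion cancels the mixed terms of the Levi-Civita connection: `E₁` and `E₈` become
parallel, and on the base `σⁱⱼ = -de¹(Eᵢ, Eⱼ) e¹ - de⁸(Eᵢ, Eⱼ) e⁸`. -/
theorem plusConnection_eq (hρ : ∀ k, dCoframe a b c k = den ρ (dCoframeM k)) :
    plusConnection (torsion (PhiField Γ)) =
      denConn Γ ρ (torusM [(-2, [0])] [(-2, [1])] [(2, [2])]) := by
  have h : ∀ i j : Fin 8, sameM (torusM [(-2, [0])] [(-2, [1])] [(2, [2])] i j)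
      (lcM i j ++ scaleM (-1) (sumM fun k => smulM (evalM halfTM [i, j, k]) (covecM k)))
      = true := by
    decide +kernel
  have h2 : den ρ (scaleM 2 halfTM) = (2 : ℝ) • den ρ halfTM := by
    exact_mod_cast den_scaleM ρ 2 halfTM
  rw [denConn_congr h]
  funext i j x
  rw [plusConnection, leviCivita_eq hρ, torsion_eq hρ]
  simp only [denConn, den_append, den_neg, den_sumM, den_smulM, polyVal_evalM, den_covecM, h2,
    sub_eq_add_neg]
  congr 2
  refine Finset.sum_congr rfl fun k _ => ?_
  congr 1
  simp only [eval, Pi.smul_apply, smul_eq_mul, mul_assoc, ← Finset.mul_sum]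
  ring

end Invariant

section Family

variable {a b c : ℝ} {Γ : Subgroup (H8 a b c)} {ρ : Fin 6 → ℝ}

theorem den_nil (ρ : Fin 6 → ℝ) : den ρ [] = 0 := rfl

theorem polyVal_nil (ρ : Fin 6 → ℝ) : polyVal ρ [] = 0 := rfl

theorem polyVal_cons (ρ : Fin 6 → ℝ) (t : ℤ × List (Fin 6)) (P : Poly) :
    polyVal ρ (t :: P) = t.1 * wordVal ρ t.2 + polyVal ρ P := by
  simp [polyVal]

/-! ### Curvature of the family -/

/-- The curvature forms above the diagonal of the generic member of the family. -/
def genericCurvUpper : ℕ → ℕ → SForm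
  | 1, 2 => smulM [(1, [3])] (dCoframeM 7)
  | 3, 4 => smulM [(1, [4])] (dCoframeM 7)
  | 5, 6 => smulM [(-1, [3]), (-1, [4])] (dCoframeM 7)
  | 1, 3 => smulM [(-1, [5])] (dCoframeM 0) ++ [(-1, [3, 5], 129), (1, [4, 5], 129)]
  | 1, 4 => smulM [(-1, [5])] (dCoframeM 0) ++ [(1, [3, 5], 129), (-1, [4, 5], 129)]
  | 2, 3 => smulM [(1, [5])] (dCoframeM 0) ++ [(-1, [3, 5], 129), (1, [4, 5], 129)]
  | 2, 4 => smulM [(-1, [5])] (dCoframeM 0) ++ [(-1, [3, 5], 129), (1, [4, 5], 129)]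
  | _, _ => []

/-- The curvature forms of the generic member of the family. -/
def genericCurvM : Fin 8 → Fin 8 → SForm := skewM genericCurvUpper

/-- Mask 129 is `e¹⁸`; its coefficient is the commutator of the diagonal and off-diagonal matrices,
a multiple of `(p - q) s`. -/
theorem curvature_genericM (hρ : ∀ k, dCoframe a b c k = den ρ (dCoframeM k)) :
    curvature (denConn Γ ρ genericM) = denConn Γ ρ genericCurvM := by
  rw [curvature_denConn hρ]
  exact denConn_congr (by decide +kernel)

/-- The coefficient `2 (p² + pq + q²)`. -/
def normM : Poly := [(2, [3, 3]), (2, [3, 4]), (2, [4, 4])]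

/-- The `e¹⁸` terms drop out even for `p ≠ q`: `e¹⁸` squares to zero, and its coefficient `[X, Y]`
is trace-orthogonal to both `X` and `Y`. -/
theorem pontrjagin_genericM (hρ : ∀ k, dCoframe a b c k = den ρ (dCoframeM k))
    (x : Nilmanifold Γ) :
    pontrjagin (denConn Γ ρ genericM) x = (1 / (8 * Real.pi ^ 2)) •
      ((2 * (ρ 3 ^ 2 + ρ 3 * ρ 4 + ρ 4 ^ 2)) • den ρ (wedgeM (dCoframeM 7) (dCoframeM 7))
        + (4 * ρ 5 ^ 2) • den ρ (wedgeM (dCoframeM 0) (dCoframeM 0))) := by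
  have h : sameM (pontM genericCurvM) (smulM normM (wedgeM (dCoframeM 7) (dCoframeM 7)) ++
      smulM [(4, [5, 5])] (wedgeM (dCoframeM 0) (dCoframeM 0))) = true := by
    decide +kernel
  have h1 : polyVal ρ normM = 2 * (ρ 3 ^ 2 + ρ 3 * ρ 4 + ρ 4 ^ 2) := by
    simp [polyVal, normM, wordVal]; ring
  have h2 : polyVal ρ [(4, [5, 5])] = 4 * ρ 5 ^ 2 := by
    simp [polyVal, wordVal]; ring
  have h3 := den_eq_of_sameM ρ h
  rw [den_append, den_smulM, den_smulM, h1, h2] at h3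
  rw [pontrjagin_of_curvature (curvature_genericM hρ), h3]

/-- With `p = q` the diagonal matrix is a scalar complex structure on `E₂, …, E₅`, which commutes
with the off-diagonal one. The same variable is used twice so that the commutator cancels
symbolically. -/
theorem curvature_torusM_diag (hρ : ∀ k, dCoframe a b c k = den ρ (dCoframeM k)) :
    curvature (denConn Γ ρ (torusM [(1, [3])] [(1, [3])] [(1, [5])])) =
      denConn Γ ρ fun i j =>
        smulM (evalM (torusM [(1, [3])] [(1, [3])] [(1, [5])] i j) [0]) (dCoframeM 0) ++
        smulM (evalM (torusM [(1, [3])] [(1, [3])] [(1, [5])] i j) [7]) (dCoframeM 7) := by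
  rw [curvature_denConn hρ]
  exact denConn_congr (by decide +kernel)

/-! ### Compatibility with the metric and `Φ`, and the instanton equation -/

theorem isMetric_skewM (f : ℕ → ℕ → SForm) : IsMetric (denConn Γ ρ (skewM f)) := by
  intro i j x
  rcases lt_trichotomy i j with h | h | h
  · simp [denConn, skewM, h, h.not_gt, den_neg]
  · simp [denConn, skewM, h, den, polyLin]
  · simp [denConn, skewM, h, h.not_gt, den_neg]

/-- The connection matrices are complex linear and trace-free, hence in `su(3)`, which stabilizes
`ω`, `Ψ`, `e¹` and `e⁸`. -/
theorem covDeriv_genericM_Phi (m : Fin 8) (x : Nilmanifold Γ) :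
    covDeriv (denConn Γ ρ genericM) m (PhiField Γ) x = 0 := by
  have h : ∀ m, sameM (covM genericM m phiM) [] = true := by decide +kernel
  have hP : PhiField Γ = fun _ => den ρ phiM := by funext x; exact Phi_eq ρ
  rw [hP, covDeriv_denConn, den_eq_of_sameM ρ (h m)]
  rfl

theorem eval_add (α β : Form) (l : List (Fin 8)) : eval (α + β) l = eval α l + eval β l := by
  simp [eval, add_mul, Finset.sum_add_distrib]

theorem eval_smul (r : ℝ) (α : Form) (l : List (Fin 8)) : eval (r • α) l = r * eval α l := by
  simp [eval, Finset.mul_sum, mul_assoc]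

/-- The eigenvalue `-2` characterizes `spin(7)` among 2-forms, and each `deᵏ` lies in it. -/
theorem selfDual_dCoframeM (k : Fin 8) (m n : Fin 8) :
    ∑ i, ∑ j, eval (den ρ (dCoframeM k)) [i, j] * eval Phi [m, n, i, j]
      = -2 * eval (den ρ (dCoframeM k)) [m, n] := by
  have h : ∀ k m n : Fin 8, sameM
      (sumM fun i : Fin 8 => sumM fun j : Fin 8 =>
        mulM (evalM (dCoframeM k) [i, j]) (evalM phiM [m, n, i, j]))
      (scaleM (-2) (evalM (dCoframeM k) [m, n])) = true := by
    decide +kernel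
  have h2 := polyVal_eq_of_sameM ρ (h k m n)
  simp only [polyVal_sumM, polyVal_mulM, polyVal_scaleM, polyVal_evalM] at h2
  rw [Phi_eq ρ, h2]
  norm_num

theorem instantonA_eq (a b c l q m : ℝ) (Γ : Subgroup (H8 a b c)) :
    instantonA Γ l m =
      denConn Γ (env a b c l q m) (torusM [(1, [3])] [(1, [3])] [(1, [5])]) := by
  funext i j x
  fin_cases i <;> fin_cases j <;>
    simp [instantonA, denConn, torusM, skewM, torusUpper, den_smulM, den_neg, den_covecM,
      polyVal_scaleM, polyVal_cons, polyVal_nil, den_nil, wordVal, env] <;> module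

end Family

/-! ### Spinors -/

/-- The basis spinors. -/
def basisSpinor (t : Fin 16) : Spinor := Pi.single t 1

/-- Clifford multiplication as a linear map. -/
def cliffordₗ (i : Fin 8) : Spinor →ₗ[ℝ] Spinor where
  toFun := clifford i
  map_add' x y := by funext s; simp [clifford, mul_add]
  map_smul' r x := by funext s; simp [clifford, mul_left_comm]

theorem clifford_basisSpinor (i : Fin 8) (t : Fin 16) :
    clifford i (basisSpinor t) =
      cliffordSign i (t ^^^ cliffordShift i) • basisSpinor (t ^^^ cliffordShift i) := by
  have h : ∀ (i : Fin 8) (s t : Fin 16), s ^^^ cliffordShift i = t ↔ s = t ^^^ cliffordShift i := by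
    decide +kernel
  funext s
  by_cases hs : s = t ^^^ cliffordShift i
  · have h2 := (h i s t).2 hs
    subst hs
    simp [clifford, basisSpinor, h2]
  · have h2 : s ^^^ cliffordShift i ≠ t := fun e => hs ((h i s t).1 e)
    simp only [clifford, basisSpinor, Pi.smul_apply, Pi.single_eq_of_ne h2,
      Pi.single_eq_of_ne hs]
    simp

/-- The sparse Clifford action of a list of vectors of the frame on the first basis spinor. -/
def cliffordM (L : List (Fin 8)) : List (ℤ × Fin 16) :=
  L.foldr (fun i => bindM fun t =>
    [(cliffordSign i (t ^^^ cliffordShift i), t ^^^ cliffordShift i)]) [(1, 0)]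

theorem lin_cliffordM (L : List (Fin 8)) :
    lin basisSpinor (cliffordM L) = L.foldr clifford (basisSpinor 0) := by
  induction L with
  | nil => simp [cliffordM]
  | cons i L ih =>
    rw [List.foldr_cons, ← ih]
    exact lin_bindM basisSpinor basisSpinor (cliffordₗ i).toAddMonoidHom
      (fun t => [(cliffordSign i (t ^^^ cliffordShift i), t ^^^ cliffordShift i)])
      (fun t => by
        change _ = clifford i (basisSpinor t)
        rw [clifford_basisSpinor]
        simp) (cliffordM L)

/-- The positions of the nonzero bits of a mask. -/
def maskList (x : ℕ) : List (Fin 8) := (List.finRange 8).filter fun i => x.testBit i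

theorem cliffordSet_maskSet (x : ℕ) :
    cliffordSet (maskSet x) (basisSpinor 0) = lin basisSpinor (cliffordM (maskList x)) := by
  rw [lin_cliffordM, cliffordSet, maskList]
  congr 1
  exact List.filter_congr fun i _ => by simp

/-- The Clifford action of forms on a fixed spinor as a linear map. -/
def cliffordFormₗ (ψ : Spinor) : Form →ₗ[ℝ] Spinor where
  toFun α := cliffordForm α ψ
  map_add' α β := by simp [cliffordForm, add_smul, Finset.sum_add_distrib]
  map_smul' r α := by simp [cliffordForm, mul_smul, Finset.smul_sum]

theorem cliffordForm_basisForm (A : Finset (Fin 8)) (ψ : Spinor) :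
    cliffordForm (basisForm A) ψ = cliffordSet A ψ := by
  rw [cliffordForm, Finset.sum_eq_single A]
  · simp [basisForm]
  · intro S _ h; simp [basisForm, h]
  · simp

/-- The sparse Clifford action of forms on the first basis spinor. -/
def cliffordFormM : SForm → List (ℤ × List (Fin 6) × Fin 16) :=
  mapM fun x => cliffordM (maskList x)

theorem cliffordForm_den (ρ : Fin 6 → ℝ) (s : SForm) :
    cliffordForm (den ρ s) (basisSpinor 0) = polyLin ρ basisSpinor (cliffordFormM s) :=
  (polyLin_mapM ρ _ _ (cliffordFormₗ (basisSpinor 0)) _ (fun x => by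
    change _ = cliffordForm _ _
    rw [cliffordForm_basisForm, cliffordSet_maskSet]) s).symm

/-- Each `deᵏ` lies in the stabilizer algebra `spin(7)` of the spinor. -/
theorem cliffordForm_dCoframeM (ρ : Fin 6 → ℝ) (k : Fin 8) :
    cliffordForm (den ρ (dCoframeM k)) (basisSpinor 0) = 0 := by
  have h : ∀ k, sameM (cliffordFormM (dCoframeM k)) [] = true := by decide +kernel
  rw [cliffordForm_den, polyLin, lin_eq_of_sameM (h k), lin_nil]

/-- The coefficient of the first basis spinor. -/
def headM : List (ℤ × Fin 16) → Poly := bindM fun t => if t = 0 then [(1, [])] else []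

theorem polyVal_headM (ρ : Fin 6 → ℝ) (s : List (ℤ × Fin 16)) :
    polyVal ρ (headM s) = basisSpinor 0 ⬝ᵥ lin basisSpinor s := by
  have h := lin_bindM basisSpinor (wordVal ρ) (Pi.evalAddMonoidHom (fun _ : Fin 16 => ℝ) 0)
    (fun t => if t = 0 then [(1, [])] else []) (fun t => by
      by_cases ht : t = 0
      · simp [ht, basisSpinor, wordVal]
      · simp [ht, basisSpinor, Ne.symm ht]) s
  rw [polyVal, headM, h]
  simp [basisSpinor]

theorem corresponds_basisSpinor : Corresponds Phi (basisSpinor 0) := by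
  refine ⟨by simp [basisSpinor], fun S hS => ?_⟩
  obtain ⟨x, rfl⟩ := exists_maskSet S
  have h : ∀ x : Fin 256, (maskSet x).card = 4 → sameM (pairM phiM [(1, [], x)])
      (scaleM (-1) (headM (cliffordM (maskList x)))) = true := by
    decide +kernel
  -- No variable occurs in these coefficients, so any values would serve.
  have h2 := polyVal_eq_of_sameM (fun _ => 0) (h x hS)
  rw [polyVal_pairM, polyVal_scaleM, polyVal_headM, ← cliffordSet_maskSet, ← Phi_eq] at h2
  have h3 : pairₗ Phi (den (fun _ => 0) [(1, [], (x : ℕ))]) = Phi (maskSet x) := by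
    change ∑ S, Phi S * _ = _
    rw [Finset.sum_eq_single (maskSet x)]
    · simp [den, polyLin, wordVal, basisForm]
    · intro S _ hS; simp [den, polyLin, wordVal, basisForm, hS]
    · simp
  rw [← h3, h2]
  simp

theorem cliffordSet_univ_basisSpinor :
    cliffordSet Finset.univ (basisSpinor 0) = basisSpinor 0 := by
  have h : sameM (cliffordM (maskList 255)) [(1, 0)] = true := by decide +kernel
  have h2 : Finset.univ = maskSet 255 := by decide +kernel
  rw [h2, cliffordSet_maskSet, lin_eq_of_sameM h]
  simp

/-! ### The supersymmetry equations for the constant spinor -/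

section Equations

variable {a b c : ℝ} {Γ : Subgroup (H8 a b c)} {ρ : Fin 6 → ℝ}

/-- The sparse spinor covariant derivative of the first basis spinor, up to a factor. -/
def spinM (S : Fin 8 → Fin 8 → SForm) (m : Fin 8) : List (ℤ × List (Fin 6) × Fin 16) :=
  sumM fun i : Fin 8 => sumM fun j : Fin 8 =>
    bindM₂ (fun w t => [(1, w, t)]) (evalM (S j i) [m]) (cliffordM [i, j])

theorem spinDeriv_denConn (S : Fin 8 → Fin 8 → SForm) (m : Fin 8) (x : Nilmanifold Γ) :
    spinDeriv (denConn Γ ρ S) m (fun _ => basisSpinor 0) x =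
      (1 / 4 : ℝ) • polyLin ρ basisSpinor (spinM S m) := by
  rw [spinDeriv, frameDeriv_const, zero_add, spinM, polyLin, lin_sumM]
  simp only [lin_sumM]
  congr 1
  refine Finset.sum_congr rfl fun i _ => Finset.sum_congr rfl fun j _ => ?_
  have h := lin_bindM₂ (wordVal ρ) basisSpinor
    (fun k : List (Fin 6) × Fin 16 => wordVal ρ k.1 • basisSpinor k.2)
    (smulAddHom ℝ Spinor) (fun w t => [(1, w, t)]) (fun w t => by simp)
    (evalM (S j i) [m]) (cliffordM [i, j])
  rw [h, lin_cliffordM, ← polyVal, polyVal_evalM]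
  rfl

theorem spinDeriv_genericM (m : Fin 8) (x : Nilmanifold Γ) :
    spinDeriv (denConn Γ ρ genericM) m (fun _ => basisSpinor 0) x = 0 := by
  have h : ∀ m, sameM (spinM genericM m) [] = true := by decide +kernel
  rw [spinDeriv_denConn, polyLin, lin_eq_of_sameM (h m), lin_nil, smul_zero]

/-- Since `T = e¹ ∧ de¹ + e⁸ ∧ de⁸`, it acts as `e¹ · de¹ + e⁸ · de⁸`, and `de¹, de⁸` kill the
spinor. -/
theorem cliffordForm_torsion (hρ : ∀ k, dCoframe a b c k = den ρ (dCoframeM k))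
    (x : Nilmanifold Γ) : cliffordForm (torsion (PhiField Γ) x) (basisSpinor 0) = 0 := by
  have h : sameM (cliffordFormM (scaleM 2 halfTM)) [] = true := by decide +kernel
  rw [torsion_eq hρ, cliffordForm_den, polyLin, lin_eq_of_sameM h, lin_nil]

/-! ### The equations of motion -/

theorem polyVal_ite (P : Prop) [Decidable P] (s : Poly) :
    polyVal ρ (if P then s else []) = if P then polyVal ρ s else 0 := by
  split_ifs <;> rfl

/-- The sparse tensor `∑_m ∑_{r<s} R_{rs}(Eᵢ, E_m) R_{rs}(Eⱼ, E_m)`. -/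
def curvSqM (R : Fin 8 → Fin 8 → SForm) (i j : Fin 8) : Poly :=
  sumM fun m : Fin 8 => sumM fun r : Fin 8 => sumM fun s : Fin 8 =>
    if r < s then mulM (evalM (R r s) [i, m]) (evalM (R r s) [j, m]) else []

theorem curvSq_of_curvature {σ : Connection Γ} {R : Fin 8 → Fin 8 → SForm}
    (h : curvature σ = denConn Γ ρ R) (x : Nilmanifold Γ) (i j : Fin 8) :
    curvSq σ x i j = polyVal ρ (curvSqM R i j) := by
  simp only [curvSq, h, denConn, curvSqM, polyVal_sumM, polyVal_ite, polyVal_mulM, polyVal_evalM]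

/-- The sparse diagonal entries of the quadratic curvature tensor of the generic connection. -/
def curvSqDiagM : Fin 8 → Poly :=
  ![[(4, [3, 3, 5, 5]), (-8, [3, 4, 5, 5]), (4, [4, 4, 5, 5])],
    mulM [(4, [0, 0])] normM ++ [(32, [2, 2, 5, 5])],
    mulM [(4, [0, 0])] normM ++ [(32, [2, 2, 5, 5])],
    mulM [(4, [1, 1])] normM ++ [(32, [2, 2, 5, 5])],
    mulM [(4, [1, 1])] normM ++ [(32, [2, 2, 5, 5])],
    mulM [(4, [0, 0]), (8, [0, 1]), (4, [1, 1])] normM,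
    mulM [(4, [0, 0]), (8, [0, 1]), (4, [1, 1])] normM,
    [(4, [3, 3, 5, 5]), (-8, [3, 4, 5, 5]), (4, [4, 4, 5, 5])]]

/-- The fibre entries equal `4(p - q)² s²`, the contribution of the `e¹⁸` curvature. They are what
obstructs the Einstein equation when `a ≠ b`. -/
theorem curvSq_genericM (hρ : ∀ k, dCoframe a b c k = den ρ (dCoframeM k))
    (x : Nilmanifold Γ) (i j : Fin 8) :
    curvSq (denConn Γ ρ genericM) x i j = if i = j then polyVal ρ (curvSqDiagM i) else 0 := by
  have h : ∀ i j, sameM (curvSqM genericCurvM i j) (if i = j then curvSqDiagM i else [])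
      = true := by
    decide +kernel
  rw [curvSq_of_curvature (curvature_genericM hρ), polyVal_eq_of_sameM ρ (h i j), polyVal_ite]

/-- The sparse tensor `Ric - H²/4`. -/
def ricciFluxM (i j : Fin 8) : Poly :=
  (sumM fun k => evalM (curvM lcM k j) [k, i]) ++
    scaleM (-1) (sumM fun m : Fin 8 => sumM fun n : Fin 8 =>
      mulM (evalM halfTM [i, m, n]) (evalM halfTM [j, m, n]))

/-- The sparse diagonal entries of `Ric - H²/4`. -/
def ricciFluxDiagM : Fin 8 → Poly :=
  ![[], [(-8, [2, 2]), (-4, [0, 0])], [(-8, [2, 2]), (-4, [0, 0])],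
    [(-8, [2, 2]), (-4, [1, 1])], [(-8, [2, 2]), (-4, [1, 1])],
    [(-4, [0, 0]), (-8, [0, 1]), (-4, [1, 1])], [(-4, [0, 0]), (-8, [0, 1]), (-4, [1, 1])], []]

theorem ricci_sub_flux (hρ : ∀ k, dCoframe a b c k = den ρ (dCoframeM k))
    (x : Nilmanifold Γ) (i j : Fin 8) :
    ricci x i j - 1 / 4 * ∑ m, ∑ n, eval (torsion (PhiField Γ) x) [i, m, n]
      * eval (torsion (PhiField Γ) x) [j, m, n]
      = if i = j then polyVal ρ (ricciFluxDiagM i) else 0 := by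
  have h : ∀ i j, sameM (ricciFluxM i j) (if i = j then ricciFluxDiagM i else []) = true := by
    decide +kernel
  rw [← polyVal_ite, ← polyVal_eq_of_sameM ρ (h i j), ricciFluxM, ricci, leviCivita_eq hρ,
    curvature_denConn hρ, torsion_eq hρ]
  simp only [denConn, polyVal_append, polyVal_scaleM, polyVal_sumM, polyVal_mulM, polyVal_evalM,
    den_scaleM, eval_smul, Finset.mul_sum, sub_eq_add_neg, ← Finset.sum_neg_distrib]
  congr 1
  refine Finset.sum_congr rfl fun m _ => Finset.sum_congr rfl fun n _ => ?_
  push_cast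
  ring

/-- Co-closedness of `T`: up to sign `*T` is `dΦ`, which is closed. The scalar `r` stands for the
dilaton factor. -/
theorem divergence_torsion (hρ : ∀ k, dCoframe a b c k = den ρ (dCoframeM k)) (r : ℝ)
    (x : Nilmanifold Γ) :
    ∑ i, contract i (covDeriv (leviCivita Γ) i (fun q => r • torsion (PhiField Γ) q) x) = 0 := by
  have h : sameM (sumM fun i => contractM i (covM lcM i (scaleM 2 halfTM))) [] = true := by
    decide +kernel
  have h2 := den_eq_of_sameM ρ h
  simp only [den_sumM, den_contractM, den_nil] at h2
  rw [leviCivita_eq hρ, torsion_eq hρ]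
  simp only [covDeriv_smul_const, covDeriv_denConn, contract_smul, ← Finset.smul_sum, h2,
    smul_zero]

end Equations

/-! ### Specialization to `∇⁺` and `A_{λ,μ}` -/

section Main

variable {a b c : ℝ} {Γ : Subgroup (H8 a b c)} {ρ : Fin 6 → ℝ}

theorem plusConnection_eq_genericM {a b : ℝ} (c : ℝ) (ha : a ≠ 0) (Γ : Subgroup (H8 a b c)) :
    plusConnection (torsion (PhiField Γ)) = denConn Γ (env a b c (-a) (-b) c) genericM := by
  rw [plusConnection_eq (dCoframe_eq c (-a) (-b) c ha)]
  -- The parameters `-2(a/2)` and `p` are different polynomials that agree only at the chosen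
  -- values, so the comparison is made after evaluation.
  have h : ∀ (P P' Q Q' S S' : Poly) (ρ : Fin 6 → ℝ), polyVal ρ P = polyVal ρ P' →
      polyVal ρ Q = polyVal ρ Q' → polyVal ρ S = polyVal ρ S' →
      denConn Γ ρ (torusM P Q S) = denConn Γ ρ (torusM P' Q' S') := by
    intro P P' Q Q' S S' ρ hP hQ hS
    have hu : ∀ i j : ℕ, den ρ (torusUpper P Q S i j) = den ρ (torusUpper P' Q' S' i j) := by
      intro i j
      unfold torusUpper
      split <;> simp only [den_smulM, polyVal_scaleM, polyVal_append, hP, hQ, hS]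
    funext i j x
    simp only [denConn, torusM, skewM]
    split_ifs
    · exact hu _ _
    · rw [den_neg, den_neg, hu]
    · rfl
  refine h _ _ _ _ _ _ _ ?_ ?_ ?_ <;> simp [polyVal, wordVal, env] <;> ring

theorem instantonA_eq_genericM (a b c l m : ℝ) (Γ : Subgroup (H8 a b c)) :
    instantonA Γ l m = denConn Γ (env a b c l l m) genericM := by
  rw [instantonA_eq a b c l l m]
  funext i j x
  fin_cases i <;> fin_cases j <;>
    simp [denConn, genericM, torusM, skewM, torusUpper, den_smulM, den_neg, den_covecM,
      polyVal_scaleM, polyVal_cons, polyVal_nil, wordVal, env]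

/-- Linear conditions on the curvature, such as the instanton and gaugino equations, thereby reduce
to `de¹` and `de⁸`. -/
theorem curvature_instantonA {a b : ℝ} (c l m : ℝ) (ha : a ≠ 0) (Γ : Subgroup (H8 a b c))
    (i j : Fin 8) : ∃ r s : ℝ, ∀ x, curvature (instantonA Γ l m) i j x =
      r • den (env a b c l l m) (dCoframeM 0) + s • den (env a b c l l m) (dCoframeM 7) := by
  rw [instantonA_eq a b c l l m, curvature_torusM_diag (dCoframe_eq c l l m ha)]
  exact ⟨_, _, fun x => by rw [denConn, den_append, den_smulM, den_smulM]⟩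

theorem isSpin7Instanton {a b : ℝ} (c l m : ℝ) (ha : a ≠ 0) (Γ : Subgroup (H8 a b c)) :
    IsSpin7Instanton (PhiField Γ) (instantonA Γ l m) where
  isMetric := by
    rw [instantonA_eq a b c l l m]
    exact isMetric_skewM _
  parallel k x := by
    rw [instantonA_eq_genericM]
    exact covDeriv_genericM_Phi k x
  curv i j x k n := by
    obtain ⟨r, s, h⟩ := curvature_instantonA c l m ha Γ i j
    have h0 := selfDual_dCoframeM (ρ := env a b c l l m) 0 k n
    have h7 := selfDual_dCoframeM (ρ := env a b c l l m) 7 k n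
    simp only [h, PhiField, eval_add, eval_smul, add_mul, mul_assoc, Finset.sum_add_distrib,
      ← Finset.mul_sum, h0, h7]
    ring

theorem isKillingSpinor {a b : ℝ} (c l m φ₀ : ℝ) (ha : a ≠ 0) (Γ : Subgroup (H8 a b c)) :
    IsKillingSpinor (fun _ => φ₀) (torsion (PhiField Γ)) (instantonA Γ l m)
      (fun _ => basisSpinor 0) where
  smooth := contDiff_const
  ne_zero _ h := by simpa [basisSpinor] using congrFun h 0
  chiral := Or.inl fun _ => cliffordSet_univ_basisSpinor
  gravitino k x := by
    rw [plusConnection_eq_genericM c ha]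
    exact spinDeriv_genericM k x
  dilatino x := by
    rw [cliffordForm_torsion (dCoframe_eq c 0 0 0 ha)]
    simp [frameDeriv_const]
  gaugino i j x := by
    obtain ⟨r, s, h⟩ := curvature_instantonA c l m ha Γ i j
    have h2 := map_add (cliffordFormₗ (basisSpinor 0))
      (r • den (env a b c l l m) (dCoframeM 0)) (s • den (env a b c l l m) (dCoframeM 7))
    rw [map_smul, map_smul] at h2
    rw [h]
    refine h2.trans ?_
    change r • cliffordForm _ _ + s • cliffordForm _ _ = 0
    rw [cliffordForm_dCoframeM, cliffordForm_dCoframeM]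
    simp

theorem den_env (a b c p q s p' q' s' : ℝ) (ha : a ≠ 0) (k : Fin 8) :
    den (env a b c p q s) (dCoframeM k) = den (env a b c p' q' s') (dCoframeM k) := by
  rw [← dCoframe_eq c p q s ha, dCoframe_eq c p' q' s' ha]

theorem anomalyCancellation {a b c l m : ℝ} (ha : a ≠ 0) (Γ : Subgroup (H8 a b c))
    (h₁ : 3 * l ^ 2 < a ^ 2 + a * b + b ^ 2)
    (h₂ : 3 * l ^ 2 - 2 * m ^ 2 = a ^ 2 + a * b + b ^ 2 - 2 * c ^ 2) :
    AnomalyCancellation (2 * (a ^ 2 + a * b + b ^ 2 - 3 * l ^ 2)⁻¹) (torsion (PhiField Γ))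
      (plusConnection (torsion (PhiField Γ))) (instantonA Γ l m) := by
  intro x
  have hD : a ^ 2 + a * b + b ^ 2 - 3 * l ^ 2 ≠ 0 := by linarith
  have hpi := Real.pi_ne_zero
  rw [plusConnection_eq_genericM c ha, instantonA_eq_genericM a b c l m,
    pontrjagin_genericM (dCoframe_eq c _ _ _ ha), pontrjagin_genericM (dCoframe_eq c _ _ _ ha),
    extD_torsion (dCoframe_eq c l l m ha), den_append]
  simp only [den_wedgeM, den_env a b c (-a) (-b) c l l m ha]
  generalize wedge (den (env a b c l l m) (dCoframeM 0)) (den (env a b c l l m) (dCoframeM 0)) = X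
  generalize wedge (den (env a b c l l m) (dCoframeM 7)) (den (env a b c l l m) (dCoframeM 7)) = Y
  have e1 : ∀ p q s : ℝ, env a b c p q s 3 = p ∧ env a b c p q s 4 = q ∧ env a b c p q s 5 = s :=
    fun p q s => ⟨rfl, rfl, rfl⟩
  simp only [e1]
  -- With `D = a² + ab + b² - 3λ²` and `α' = 2/D`, the `Y` coefficient is `D · α'/2 = 1`; the `X`
  -- coefficient is `(c² - m²) α'`, which is 1 because `h₂` says `c² - m² = D/2`.
  have e2 : (-a) ^ 2 + -a * -b + (-b) ^ 2 = (a ^ 2 + a * b + b ^ 2 - 3 * l ^ 2) + 3 * l ^ 2 := by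
    ring
  have hc : c ^ 2 = (a ^ 2 + a * b + b ^ 2 - 3 * l ^ 2) / 2 + m ^ 2 := by linarith
  rw [e2, hc]
  generalize a ^ 2 + a * b + b ^ 2 - 3 * l ^ 2 = D at hD
  funext S
  simp only [Pi.add_apply, Pi.smul_apply, Pi.sub_apply, smul_eq_mul]
  field_simp
  ring

theorem yangMills {a b : ℝ} (c l m r : ℝ) (ha : a ≠ 0) (Γ : Subgroup (H8 a b c)) (i j : Fin 8)
    (x : Nilmanifold Γ) :
    ∑ k, contract k
      (covDeriv (plusConnection (torsion (PhiField Γ))) k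
          (fun q => r • curvature (instantonA Γ l m) i j q) x
        + r • ∑ t, (eval (instantonA Γ l m i t x) [k] • curvature (instantonA Γ l m) t j x
          - eval (instantonA Γ l m t j x) [k] • curvature (instantonA Γ l m) i t x)) = 0 := by
  let A := torusM [(1, [3])] [(1, [3])] [(1, [5])]
  let F : Fin 8 → Fin 8 → SForm := fun i j =>
    smulM (evalM (A i j) [0]) (dCoframeM 0) ++ smulM (evalM (A i j) [7]) (dCoframeM 7)
  -- Here `∇⁺` is written in `a/2, b/2, c/2`, because the variables `p` and `s` already carry `λ`
  -- and `μ`.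
  have h : ∀ i j : Fin 8, sameM (sumM fun k => contractM k
      (covM (torusM [(-2, [0])] [(-2, [1])] [(2, [2])]) k (F i j) ++
        sumM fun t => smulM (evalM (A i t) [k]) (F t j) ++
          scaleM (-1) (smulM (evalM (A t j) [k]) (F i t)))) [] = true := by
    decide +kernel
  have h2 := den_eq_of_sameM (env a b c l l m) (h i j)
  simp only [den_sumM, den_contractM, den_append, den_neg, den_smulM, polyVal_evalM,
    den_nil, ← sub_eq_add_neg] at h2
  rw [plusConnection_eq (dCoframe_eq c l l m ha), instantonA_eq a b c l l m,
    curvature_torusM_diag (dCoframe_eq c l l m ha)]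
  change ∑ k, contract k (covDeriv (denConn Γ _ _) k
    (fun q => r • den (env a b c l l m) (F i j)) x + r • ∑ t,
      (eval (den (env a b c l l m) (A i t)) [k] • den (env a b c l l m) (F t j)
        - eval (den (env a b c l l m) (A t j)) [k] • den (env a b c l l m) (F i t))) = 0
  simp only [covDeriv_smul_const, covDeriv_denConn, ← smul_add, contract_smul, ← Finset.smul_sum]
  rw [h2, smul_zero]

theorem equationsOfMotion {a c l m : ℝ} (ha : a ≠ 0) (Γ : Subgroup (H8 a a c)) (φ₀ : ℝ)
    (h₁ : 3 * l ^ 2 < a ^ 2 + a * a + a ^ 2)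
    (h₂ : 3 * l ^ 2 - 2 * m ^ 2 = a ^ 2 + a * a + a ^ 2 - 2 * c ^ 2) :
    EquationsOfMotion (2 * (a ^ 2 + a * a + a ^ 2 - 3 * l ^ 2)⁻¹) (fun _ => φ₀)
      (torsion (PhiField Γ)) (plusConnection (torsion (PhiField Γ))) (instantonA Γ l m) where
  einstein x i j := by
    have hD : a ^ 2 + a * a + a ^ 2 - 3 * l ^ 2 ≠ 0 := by linarith
    have hh : hessian (fun _ : Nilmanifold Γ => φ₀) x i j = 0 := by
      simp [hessian, frameDeriv_const]
    rw [ricci_sub_flux (dCoframe_eq c (-a) (-a) c ha), hh, instantonA_eq_genericM,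
      plusConnection_eq_genericM c ha, curvSq_genericM (dCoframe_eq c _ _ _ ha),
      curvSq_genericM (dCoframe_eq c _ _ _ ha)]
    by_cases hij : i = j
    · have hR : polyVal (env a a c (-a) (-a) c) (ricciFluxDiagM j) =
          ![0, -2 * c ^ 2 - a ^ 2, -2 * c ^ 2 - a ^ 2, -2 * c ^ 2 - a ^ 2, -2 * c ^ 2 - a ^ 2,
            -4 * a ^ 2, -4 * a ^ 2, 0] j := by
        fin_cases j <;>
          simp [ricciFluxDiagM, polyVal_cons, polyVal_nil, wordVal, env] <;> ring
      have hF : polyVal (env a a c l l m) (curvSqDiagM j)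
          - polyVal (env a a c (-a) (-a) c) (curvSqDiagM j) =
          (a ^ 2 + a * a + a ^ 2 - 3 * l ^ 2) *
            ![0, -4 * c ^ 2 - 2 * a ^ 2, -4 * c ^ 2 - 2 * a ^ 2, -4 * c ^ 2 - 2 * a ^ 2,
              -4 * c ^ 2 - 2 * a ^ 2, -8 * a ^ 2, -8 * a ^ 2, 0] j := by
        fin_cases j <;>
          simp [curvSqDiagM, polyVal_append, polyVal_mulM, normM, polyVal_cons,
            polyVal_nil, wordVal, env] <;>
          -- Only the entries for `E₂, …, E₅` involve `8c²(m² - c²)`, which `h₂` turns into `-4c²D`;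
          -- the remaining entries are identities.
          first | ring1 | linear_combination (-4 * c ^ 2) * h₂
      simp only [hij, if_true, hR, hF]
      generalize a ^ 2 + a * a + a ^ 2 - 3 * l ^ 2 = D at hD
      field_simp
      fin_cases j <;> simp <;> ring
    · simp [hij]
  flux x := divergence_torsion (dCoframe_eq c 0 0 0 ha) _ x
  yangMills i j x := yangMills c l m _ ha Γ i j x

end Main

end Heterotic

theorem theorem5p13 (a b c : ℝ) (ha : a ≠ 0) (hb : b ≠ 0) (hab : a + b ≠ 0)
    (Γ : Subgroup (H8 a b c)) (hΓ : IsLattice Γ) (l m : ℝ) (hlm : (l, m) ≠ (0, 0))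
    (h₁ : 3 * l ^ 2 < a ^ 2 + a * b + b ^ 2)
    (h₂ : 3 * l ^ 2 - 2 * m ^ 2 = a ^ 2 + a * b + b ^ 2 - 2 * c ^ 2) (φ₀ : ℝ) :
    CompactSpace (Nilmanifold Γ) ∧
    IsBalanced (PhiField Γ) ∧
    IsSpin7Instanton (PhiField Γ) (instantonA Γ l m) ∧
    0 < 2 * (a ^ 2 + a * b + b ^ 2 - 3 * l ^ 2)⁻¹ ∧
    AnomalyCancellation (2 * (a ^ 2 + a * b + b ^ 2 - 3 * l ^ 2)⁻¹) (torsion (PhiField Γ))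
      (plusConnection (torsion (PhiField Γ))) (instantonA Γ l m) ∧
    (∃ ψ : Nilmanifold Γ → Spinor, (∀ p, Corresponds (PhiField Γ p) (ψ p)) ∧
      IsKillingSpinor (fun _ => φ₀) (torsion (PhiField Γ)) (instantonA Γ l m) ψ) ∧
    (a = b →
      EquationsOfMotion (2 * (a ^ 2 + a * b + b ^ 2 - 3 * l ^ 2)⁻¹) (fun _ => φ₀)
        (torsion (PhiField Γ)) (plusConnection (torsion (PhiField Γ))) (instantonA Γ l m)) ∧
    (∀ x u : Fin 8 → ℝ, metric a b c x u u =
      (u 0 + c / b * (x 1 / a - x 2) * u 3 + c * (x 1 / a + x 2) * u 4) ^ 2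
        + (1 / a * u 1) ^ 2 + u 2 ^ 2 + (1 / b * u 3) ^ 2 + u 4 ^ 2
        + (-1 / (a + b) * u 5) ^ 2 + u 6 ^ 2
        + (x 1 * u 2 + x 3 * u 4 + x 5 * u 6 - u 7) ^ 2) := by
  refine ⟨hΓ.2, isBalanced (dCoframe_eq c 0 0 0 ha), isSpin7Instanton c l m ha Γ,
    mul_pos two_pos (inv_pos.2 (sub_pos.2 h₁)), anomalyCancellation ha Γ h₁ h₂,
    ⟨fun _ => basisSpinor 0, fun _ => corresponds_basisSpinor, isKillingSpinor c l m φ₀ ha Γ⟩,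
    ?_, ?_⟩
  · rintro rfl
    exact equationsOfMotion ha Γ φ₀ h₁ h₂
  · intro x u
    simp [metric, coframe, Fin.sum_univ_eight, sq]
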